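/- Let $p$ be a prime and $n\ge 1$. Equip $\mathbb{Q}_p^n$ with the norm $|x|_p=\max_{j}|x_j|_p$ and with the Haar measure $|\cdot|_h$ (also written $\mathrm{d}x$) for which the unit ball has measure $1$. For $\gamma\in\mathbb{Z}$ and $x\in\mathbb{Q}_p^n$ put $B_\gamma(x)=\{y:|x-y|_p\le p^\gamma\}$. Functions are real-valued and are identified when they agree almost everywhere. Exponents. For measurable $q(\cdot):\mathbb{Q}_p^n\to\mathbb{R}$ and a set $E$, let $q_-(E)$, $q_+(E)$ be the essential infimum and supremum of $q$ over $E$, and $q_\pm=q_\pm(\mathbb{Q}_p^n)$. Let $\mathscr{P}$ be the set of measurable $q(\cdot)$ with $1<q_-\le q(x)\le q_+<\infty$ for all $x$, and let $\mathscr{C}^{\log}$ be the set of $q(\cdot)\in\mathscr{P}$ for which there is a constant $C>0$ with $$\gamma\big(q_-(B_\gamma(x))-q_+(B_\gamma(x))\big)\le C\quad(\gamma\in\mathbb{Z},\ x\in\mathbb{Q}_p^n),\qquad |q(x)-q(y)|\le\frac{C}{\log_p(p+\min\{|x|_p,|y|_p\})}\quad(x,y\in\mathbb{Q}_p^n).$$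 For $q(\cdot)\in\mathscr{P}$, $L^{q(\cdot)}(\mathbb{Q}_p^n)$ is the set of measurable $f$ with $\int(|f(x)|/\eta)^{q(x)}\,\mathrm{d}x<\infty$ for some $\eta>0$, with the norm $\|f\|_{q(\cdot)}=\inf\{\eta>0:\int(|f(x)|/\eta)^{q(x)}\,\mathrm{d}x\le1\}$. Let $0<\beta<1$, $0<\alpha<\alpha+\beta<n$, and let $b$ be locally integrable on $\mathbb{Q}_p^n$. Let $\Lambda_\beta(\mathbb{Q}_p^n)$ be the space of measurable $f$ with $\sup_{x\ne y}|f(x)-f(y)|/|x-y|_p^\beta<\infty$. Let $$\mathcal{M}^p_{\alpha,b}(f)(x)=\sup_{\gamma\in\mathbb{Z}}\frac{1}{|B_\gamma(x)|_h^{1-\alpha/n}}\int_{B_\gamma(x)}|b(x)-b(y)|\,|f(y)|\,\mathrm{d}y,$$ and let $b_{B}=|B|_h^{-1}\int_{B}b(y)\,\mathrm{d}y$ for a ball $B$. Call a pair $r(\cdot),q(\cdot)$ admissible if $r(\cdot),q(\cdot)\in\mathscr{C}^{\log}$, $r(\cdot)\in\mathscr{P}$, $r_+<\frac{n}{\alpha+\beta}$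 and $\frac1{q(x)}=\frac1{r(x)}-\frac{\alpha+\beta}{n}$ for all $x$. Then the following assertions are equivalent. (B.1) $b\in\Lambda_\beta(\mathbb{Q}_p^n)$, that is, $b$ agrees almost everywhere with a function in $\Lambda_\beta(\mathbb{Q}_p^n)$. (B.2) For all admissible pairs $r(\cdot),q(\cdot)$, $\mathcal{M}^p_{\alpha,b}$ is bounded from $L^{r(\cdot)}(\mathbb{Q}_p^n)$ to $L^{q(\cdot)}(\mathbb{Q}_p^n)$, that is, there is a constant $C$ such that, for every $f\in L^{r(\cdot)}(\mathbb{Q}_p^n)$, $\mathcal{M}^p_{\alpha,b}(f)\in L^{q(\cdot)}(\mathbb{Q}_p^n)$ and $\|\mathcal{M}^p_{\alpha,b}(f)\|_{q(\cdot)}\le C\|f\|_{r(\cdot)}$. (B.3) For some admissible pair $r(\cdot),q(\cdot)$, $\mathcal{M}^p_{\alpha,b}$ is bounded from $L^{r(\cdot)}(\mathbb{Q}_p^n)$ to $L^{q(\cdot)}(\mathbb{Q}_p^n)$. (B.4) For some admissible pair $r(\cdot),q(\cdot)$, $$\sup_{\gamma\in\mathbb{Z},\,x\in\mathbb{Q}_p^n}\frac{1}{|B_\gamma(x)|_h^{\beta/n}}\,\frac{\big\|(b-b_{B_\gamma(x)})\chi_{B_\gamma(x)}\big\|_{q(\cdot)}}{\big\|\chi_{B_\gamma(x)}\big\|_{q(\cdot)}}<\infty.\qquad(*)$$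 (B.5) For all admissible pairs $r(\cdot),q(\cdot)$, $(*)$ holds. -/

import Mathlib

open MeasureTheory
open scoped ENNReal NNReal

namespace PadicVarLebesgue

noncomputable instance instMeasurableSpacePadic (p : ℕ) [Fact p.Prime] : MeasurableSpace ℚ_[p] :=
  borel ℚ_[p]

instance instBorelSpacePadic (p : ℕ) [Fact p.Prime] : BorelSpace ℚ_[p] := ⟨rfl⟩

/-- The space `ℚ_p^n`; as a function space it carries the maximum norm
`|x|_p = max_j |x_j|_p`. -/
abbrev Qpn (p : ℕ) [Fact p.Prime] (n : ℕ) : Type := Fin n → ℚ_[p]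

/-- The ball `B_γ(a) = {x : |x - a|_p ≤ p^γ}`. -/
def pball {p : ℕ} [Fact p.Prime] {n : ℕ} (γ : ℤ) (a : Qpn p n) : Set (Qpn p n) :=
  Metric.closedBall a ((p : ℝ) ^ γ)

/-- The unit ball `B_0(0)` as a compact set with non-empty interior. -/
def unitBall (p : ℕ) [Fact p.Prime] (n : ℕ) : TopologicalSpace.PositiveCompacts (Qpn p n) where
  carrier := pball 0 0
  isCompact' := isCompact_closedBall _ _
  interior_nonempty' :=
    ⟨0, interior_mono Metric.ball_subset_closedBall (by
      rw [Metric.isOpen_ball.interior_eq]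
      exact Metric.mem_ball_self (by simp))⟩

/-- The Haar measure on `ℚ_p^n`, normalized so that the unit ball has measure `1`. -/
noncomputable def haar (p : ℕ) [Fact p.Prime] (n : ℕ) : Measure (Qpn p n) :=
  Measure.addHaarMeasure (unitBall p n)

section Spaces

variable {p : ℕ} [Fact p.Prime] {n : ℕ}

/-- The class `𝒫(ℚ_p^n)`: measurable `q` with `1 < q_- ≤ q(x) ≤ q_+ < ∞` for all `x`, where `q_-`
and `q_+` are the essential infimum and supremum. (An essentially unbounded `q` has `essSup q = 0`
in `ℝ`, so it is excluded.) -/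
structure IsExponent (q : Qpn p n → ℝ) : Prop where
  measurable : Measurable q
  one_lt : 1 < essInf q (haar p n)
  essInf_le : ∀ x, essInf q (haar p n) ≤ q x
  le_essSup : ∀ x, q x ≤ essSup q (haar p n)

/-- The class `𝒞^log(ℚ_p^n)` of globally log-Hölder continuous exponents:
`γ (q_-(B_γ(x)) - q_+(B_γ(x))) ≤ C` for all balls, and
`|q(x) - q(y)| ≤ C / log_p(p + min(|x|_p, |y|_p))` for all points. -/
structure IsLogHolder (q : Qpn p n → ℝ) : Prop where
  isExponent : IsExponent q
  loc : ∃ C : ℝ, 0 < C ∧ ∀ (γ : ℤ) (x : Qpn p n),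
    (γ : ℝ) * (essInf q ((haar p n).restrict (pball γ x))
      - essSup q ((haar p n).restrict (pball γ x))) ≤ C
  infty : ∃ C : ℝ, 0 < C ∧ ∀ x y : Qpn p n,
    |q x - q y| ≤ C / Real.logb p (p + min ‖x‖ ‖y‖)

/-- The modular `∫ (|f(x)| / η)^{q(x)} dx`, with values in `[0, ∞]`. -/
noncomputable def modular {E : Type*} [ENorm E] (q : Qpn p n → ℝ) (f : Qpn p n → E) (η : ℝ≥0) :
    ℝ≥0∞ :=
  ∫⁻ x, (‖f x‖ₑ / (η : ℝ≥0∞)) ^ (q x) ∂(haar p n)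

/-- Membership in `L^{q(·)}(ℚ_p^n)`, for functions with values in `ℝ` or in `[0, ∞]`. -/
def MemVarLp {E : Type*} [ENorm E] [MeasurableSpace E] (q : Qpn p n → ℝ) (f : Qpn p n → E) :
    Prop :=
  AEMeasurable f (haar p n) ∧ ∃ η : ℝ≥0, 0 < η ∧ modular q f η < ∞

/-- The Luxemburg norm of `L^{q(·)}(ℚ_p^n)`, equal to `∞` if no `η` is admissible. -/
noncomputable def varNorm {E : Type*} [ENorm E] (q : Qpn p n → ℝ) (f : Qpn p n → E) : ℝ≥0∞ :=
  ⨅ (η : ℝ≥0) (_ : 0 < η ∧ modular q f η ≤ 1), (η : ℝ≥0∞)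

/-- Boundedness from `L^{r(·)}(ℚ_p^n)` to `L^{q(·)}(ℚ_p^n)` of an operator with values in
`[0, ∞]`-valued functions. -/
def IsBoundedOp (r q : Qpn p n → ℝ) (T : (Qpn p n → ℝ) → Qpn p n → ℝ≥0∞) : Prop :=
  ∃ C : ℝ≥0, ∀ f : Qpn p n → ℝ, MemVarLp r f →
    MemVarLp q (T f) ∧ varNorm q (T f) ≤ C * varNorm r f

/-- The norm `sup_{x ≠ y} |f(x) - f(y)| / |x - y|_p^β`. -/
noncomputable def lipNorm (β : ℝ) (f : Qpn p n → ℝ) : ℝ≥0∞ :=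
  ⨆ (x : Qpn p n) (y : Qpn p n) (_ : x ≠ y), ‖f x - f y‖ₑ / ‖x - y‖ₑ ^ β

/-- The homogeneous Lipschitz space `Λ_β(ℚ_p^n)`, as a set of functions. -/
def MemLip (β : ℝ) (f : Qpn p n → ℝ) : Prop :=
  Measurable f ∧ lipNorm β f < ∞

/-- The maximal commutator
`M_{α,b}(f)(x) = sup_γ |B_γ(x)|^{-(1 - α/n)} ∫_{B_γ(x)} |b(x) - b(y)| |f(y)| dy`. -/
noncomputable def maxCommutator (α : ℝ) (b f : Qpn p n → ℝ) (x : Qpn p n) : ℝ≥0∞ :=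
  ⨆ γ : ℤ, (haar p n (pball γ x) ^ (1 - α / n))⁻¹ *
    ∫⁻ y in pball γ x, ‖b x - b y‖ₑ * ‖f y‖ₑ ∂(haar p n)

/-- The supremum over all balls `B` of `|B|^{-β/n} ‖(b - b_B) χ_B‖_{q(·)} / ‖χ_B‖_{q(·)}`, where
`b_B` is the mean of `b` over `B`. -/
noncomputable def meanOsc (β : ℝ) (q b : Qpn p n → ℝ) : ℝ≥0∞ :=
  ⨆ (γ : ℤ) (x : Qpn p n), (haar p n (pball γ x) ^ (β / n))⁻¹ *
    (varNorm q ((pball γ x).indicator fun y => b y - ⨍ z in pball γ x, b z ∂(haar p n)) /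
      varNorm q ((pball γ x).indicator fun _ => (1 : ℝ)))

/-- The pairs `r(·), q(·) ∈ 𝒞^log(ℚ_p^n)` with `r(·) ∈ 𝒫(ℚ_p^n)`, `r_+ < n / s` and
`1 / q(·) = 1 / r(·) - s / n`. -/
structure IsAdmissible (s : ℝ) (r q : Qpn p n → ℝ) : Prop where
  logHolder_left : IsLogHolder r
  logHolder_right : IsLogHolder q
  isExponent : IsExponent r
  essSup_lt : essSup r (haar p n) < n / s
  rel : ∀ x, 1 / q x = 1 / r x - s / n

end Spaces

end PadicVarLebesgue

open Filter
open scoped Topology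

namespace PadicVarLebesgue

/-! ### Ultrametric balls and their Haar measure -/

section Balls

variable {p : ℕ} [Fact p.Prime] {n : ℕ}

/-! Every point of an ultrametric ball is a centre of it. So the averages at scale `γ` are constant
on balls of radius `p ^ γ`, and maximal functions behave like dyadic ones: no covering lemma is
needed.

Lipschitz implies bounded. Write `σ = (α + β) / n`. On a ball `B` a function in `Λ_β` oscillates by
at most a multiple of `|B| ^ (β / n)`, so the commutator is dominated almost everywhere by the
fractional maximal function of order `σ` (`maxCommutator_le_mul_fracMax`). The same oscillation
bound gives (*) directly. What remains is the bound of the fractional maximal function from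
`L^{r(·)}` to `L^{q(·)}` (`exists_lintegral_fracMax_div_rpow_le_one`). A Hedberg-type inequality
turns `(|B|^σ A)^q` into a multiple of `A^r` whenever the average `A` satisfies `A^r ≤ K / |B|`. The
function is cut at height 1: where it is large, the local log-Hölder condition freezes the exponent
on each ball; where it is small, the decay condition replaces the exponents by their limits at
infinity, up to the integrable error `decayFun`. Both parts then follow from the maximal theorem for
a constant exponent.

Bounded implies (*). Testing the commutator on `χ_B` bounds `|B|^(α/n) |b - b_B|` on `B`, and
`‖χ_B‖_{r(·)} ≤ C |B|^σ ‖χ_B‖_{q(·)}` (`exists_varNorm_indicator_one_le`) leaves exactly the factor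
`|B|^(β/n)`.

(*) implies Lipschitz. Boundedness of the maximal function on `L^{q(·)}` turns (*) into an `L^1`
mean oscillation bound (`exists_ballAvg_enorm_sub_average_le`). The means over shrinking balls then
converge geometrically, and their limit is the Lipschitz representative
(`exists_memLip_of_ballAvg_le`). -/

instance instIsAddHaarMeasureHaar : (haar p n).IsAddHaarMeasure := by
  unfold haar; infer_instance

instance instSigmaFiniteHaar : SigmaFinite (haar p n) := by
  unfold haar; infer_instance

lemma one_lt_prime : (1 : ℝ) < p := by exact_mod_cast (Fact.out : p.Prime).one_lt

lemma prime_pos : (0 : ℝ) < p := zero_lt_one.trans one_lt_prime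

lemma prime_ennreal_ne_zero : (p : ℝ≥0∞) ≠ 0 := by
  exact_mod_cast (Fact.out : p.Prime).ne_zero

lemma one_le_prime_ennreal : (1 : ℝ≥0∞) ≤ p := by
  exact_mod_cast (Fact.out : p.Prime).one_lt.le

lemma mem_pball {γ : ℤ} {x y : Qpn p n} : y ∈ pball γ x ↔ ‖y - x‖ ≤ (p : ℝ) ^ γ := by
  rw [pball, mem_closedBall_iff_norm]

lemma mem_pball_iff_forall {γ : ℤ} {x y : Qpn p n} :
    y ∈ pball γ x ↔ ∀ j, ‖y j - x j‖ ≤ (p : ℝ) ^ γ := by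
  rw [mem_pball, pi_norm_le_iff_of_nonneg (by have := prime_pos (p := p); positivity)]
  rfl

lemma mem_pball_self (γ : ℤ) (x : Qpn p n) : x ∈ pball γ x :=
  Metric.mem_closedBall_self (by have := prime_pos (p := p); positivity)

lemma pball_eq_of_mem {γ : ℤ} {x y : Qpn p n} (h : y ∈ pball γ x) : pball γ y = pball γ x :=
  (IsUltrametricDist.closedBall_eq_of_mem h).symm

lemma mem_pball_comm {γ : ℤ} {x y : Qpn p n} : y ∈ pball γ x ↔ x ∈ pball γ y :=
  Metric.mem_closedBall_comm

lemma pball_mono {γ δ : ℤ} (h : γ ≤ δ) (x : Qpn p n) : pball γ x ⊆ pball δ x :=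
  Metric.closedBall_subset_closedBall (zpow_le_zpow_right₀ one_lt_prime.le h)

lemma isOpen_pball (γ : ℤ) (x : Qpn p n) : IsOpen (pball γ x) :=
  IsUltrametricDist.isOpen_closedBall x (by have := prime_pos (p := p); positivity)

lemma measurableSet_pball (γ : ℤ) (x : Qpn p n) : MeasurableSet (pball γ x) :=
  (isOpen_pball γ x).measurableSet

lemma isCompact_pball (γ : ℤ) (x : Qpn p n) : IsCompact (pball γ x) :=
  isCompact_closedBall _ _

lemma haar_pball_eq_zero_center (γ : ℤ) (x : Qpn p n) :
    haar p n (pball γ x) = haar p n (pball γ 0) := by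
  have : pball γ (0 : Qpn p n) = (fun y => x + y) ⁻¹' pball γ x := by
    ext y; simp [mem_pball]
  rw [this, measure_preimage_add]

/-- The reference point of the residue class `c` in the ball of radius `p ^ γ`. -/
noncomputable def residuePoint (γ : ℤ) (c : Fin n → Fin p) : Qpn p n :=
  fun j => ((c j : ℕ) : ℚ_[p]) * (p : ℚ_[p]) ^ (-γ)

/-- Norms are powers of `p`, so `≤ p ^ (γ - 1)` means `< p ^ γ`; multiplication by `p ^ γ`, of norm
`p ^ (-γ)`, reduces the question to residues modulo `p`. -/
lemma norm_sub_residue_le_iff (γ : ℤ) (a : ℕ) (z : ℚ_[p]) :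
    ‖z - a * (p : ℚ_[p]) ^ (-γ)‖ ≤ (p : ℝ) ^ (γ - 1) ↔ ‖z * (p : ℚ_[p]) ^ γ - a‖ < 1 := by
  have hp0 : (p : ℚ_[p]) ≠ 0 := by exact_mod_cast (Fact.out : p.Prime).ne_zero
  have hp := prime_pos (p := p)
  have h1 : z * (p : ℚ_[p]) ^ γ - a = (z - a * (p : ℚ_[p]) ^ (-γ)) * (p : ℚ_[p]) ^ γ := by
    rw [sub_mul, mul_assoc, ← zpow_add₀ hp0]; simp
  rw [Padic.norm_le_pow_iff_norm_lt_pow_add_one, sub_add_cancel, h1, norm_mul,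
    Padic.norm_p_zpow, zpow_neg (p : ℝ), ← div_eq_mul_inv _ ((p : ℝ) ^ γ),
    div_lt_one (by positivity)]

lemma pball_eq_iUnion_residue (γ : ℤ) :
    pball γ (0 : Qpn p n) = ⋃ c : Fin n → Fin p, pball (γ - 1) (residuePoint γ c) := by
  have hp := prime_pos (p := p)
  ext x
  simp only [Set.mem_iUnion, mem_pball_iff_forall, residuePoint, norm_sub_residue_le_iff]
  constructor
  · intro h
    have : ∀ j, ∃ c : Fin p, ‖x j * (p : ℚ_[p]) ^ γ - (c : ℕ)‖ < 1 := by
      intro j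
      have hz : ‖x j * (p : ℚ_[p]) ^ γ‖ ≤ 1 := by
        rw [norm_mul, Padic.norm_p_zpow, zpow_neg, ← div_eq_mul_inv, div_le_one (by positivity)]
        simpa using h j
      obtain ⟨m, hm, hm'⟩ := PadicInt.exists_mem_range (⟨_, hz⟩ : ℤ_[p])
      rw [PadicInt.maximalIdeal_eq_span_p, Ideal.mem_span_singleton,
        ← PadicInt.norm_lt_one_iff_dvd] at hm'
      rw [PadicInt.norm_def] at hm'
      exact ⟨⟨m, hm⟩, hm'⟩
    choose c hc using this
    exact ⟨c, hc⟩
  · rintro ⟨c, hc⟩ j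
    have h1 : ‖x j * (p : ℚ_[p]) ^ γ‖ ≤ 1 := by
      have := IsUltrametricDist.norm_add_le_max (x j * (p : ℚ_[p]) ^ γ - (c j : ℕ))
        ((c j : ℕ) : ℚ_[p])
      rw [sub_add_cancel] at this
      refine this.trans (max_le (hc j).le ?_)
      exact_mod_cast Padic.norm_int_le_one ((c j : ℕ) : ℤ)
    rw [norm_mul, Padic.norm_p_zpow, zpow_neg, ← div_eq_mul_inv, div_le_one (by positivity)] at h1
    simpa using h1

lemma pairwise_disjoint_residue (γ : ℤ) :
    Pairwise (Function.onFun Disjoint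
      fun c : Fin n → Fin p => pball (γ - 1) (residuePoint γ c)) := by
  intro c d hcd
  refine Set.disjoint_left.2 fun x hx hy => hcd ?_
  simp only [mem_pball_iff_forall, residuePoint, norm_sub_residue_le_iff] at hx hy
  funext j
  have h1 : ‖(((d j : ℕ) : ℤ) - ((c j : ℕ) : ℤ) : ℤ_[p])‖ < 1 := by
    have := IsUltrametricDist.norm_add_le_max (x j * (p : ℚ_[p]) ^ γ - (c j : ℕ))
      (-(x j * (p : ℚ_[p]) ^ γ - (d j : ℕ)))
    rw [norm_neg, ← sub_eq_add_neg, sub_sub_sub_cancel_left] at this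
    rw [PadicInt.norm_def]
    push_cast
    exact this.trans_lt (max_lt (hx j) (hy j))
  rw [← Int.cast_sub, PadicInt.norm_int_lt_one_iff_dvd] at h1
  -- Two residues in `[0, p)` whose difference is divisible by `p` coincide.
  have h2 := Int.eq_zero_of_abs_lt_dvd h1 (by
    have := (c j).2; have := (d j).2; rw [abs_lt]; constructor <;> omega)
  exact Fin.ext (by omega)

/-- The `p ^ n` residue classes are disjoint translates of one ball of the next smaller radius. -/
lemma haar_pball_succ (γ : ℤ) (x : Qpn p n) :
    haar p n (pball γ x) = (p : ℝ≥0∞) ^ n * haar p n (pball (γ - 1) x) := by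
  rw [haar_pball_eq_zero_center, pball_eq_iUnion_residue,
    measure_iUnion (pairwise_disjoint_residue γ) fun c => measurableSet_pball _ _]
  simp_rw [haar_pball_eq_zero_center (γ - 1)]
  simp [tsum_fintype]

/-- A ball of radius `p ^ γ` has measure `p ^ (n γ)`. -/
theorem haar_pball (γ : ℤ) (x : Qpn p n) :
    haar p n (pball γ x) = (p : ℝ≥0∞) ^ ((n : ℝ) * γ) := by
  have hp := prime_ennreal_ne_zero (p := p)
  have hstep : ∀ k : ℤ, (p : ℝ≥0∞) ^ ((n : ℝ) * (k : ℝ))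
      = (p : ℝ≥0∞) ^ n * (p : ℝ≥0∞) ^ ((n : ℝ) * ((k - 1 : ℤ) : ℝ)) := by
    intro k
    rw [← ENNReal.rpow_natCast, ← ENNReal.rpow_add _ _ hp (ENNReal.natCast_ne_top p)]
    congr 1; push_cast; ring
  have hpn : (p : ℝ≥0∞) ^ n ≠ 0 := pow_ne_zero _ hp
  have hpn' : (p : ℝ≥0∞) ^ n ≠ ∞ := ENNReal.pow_ne_top (ENNReal.natCast_ne_top p)
  induction γ using Int.induction_on with
  | zero =>
    rw [haar_pball_eq_zero_center, haar]
    simpa using! Measure.addHaarMeasure_self (K₀ := unitBall p n)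
  | succ k ih =>
    rw [haar_pball_succ, hstep]
    simpa using congrArg (fun t => (p : ℝ≥0∞) ^ n * t) ih
  | pred k ih =>
    rw [haar_pball_succ, hstep] at ih
    exact (ENNReal.mul_right_inj hpn hpn').1 ih

lemma haar_pball_ne_zero (γ : ℤ) (x : Qpn p n) : haar p n (pball γ x) ≠ 0 :=
  (isOpen_pball γ x).measure_ne_zero _ ⟨x, mem_pball_self γ x⟩

lemma haar_pball_ne_top (γ : ℤ) (x : Qpn p n) : haar p n (pball γ x) ≠ ∞ :=
  (isCompact_pball γ x).measure_lt_top.ne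

lemma haar_pball_rpow_div (hn : n ≠ 0) (γ : ℤ) (x : Qpn p n) (s : ℝ) :
    haar p n (pball γ x) ^ (s / n) = (p : ℝ≥0∞) ^ (γ * s) := by
  rw [haar_pball, ← ENNReal.rpow_mul]
  congr 1
  field_simp

lemma enorm_sub_le_of_mem_pball {γ : ℤ} {x y : Qpn p n} (h : y ∈ pball γ x) :
    ‖x - y‖ₑ ≤ (p : ℝ≥0∞) ^ (γ : ℝ) := by
  rw [mem_pball, norm_sub_rev] at h
  rw [← ofReal_norm]
  refine (ENNReal.ofReal_le_ofReal h).trans_eq ?_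
  rw [← Real.rpow_intCast, ← ENNReal.ofReal_rpow_of_pos prime_pos, ENNReal.ofReal_natCast]

/-- Doubling makes the Lebesgue differentiation theorem available. For `p ^ γ ≤ ε < p ^ (γ + 1)` one
has `2 ε ≤ p ^ (γ + 2)` because `2 ≤ p`, which costs two steps in the radius. -/
instance instIsUnifLocDoublingMeasureHaar : IsUnifLocDoublingMeasure (haar p n) where
  exists_measure_closedBall_le_mul'' := by
    refine ⟨(p : ℝ≥0) ^ n * (p : ℝ≥0) ^ n, ?_⟩
    filter_upwards [self_mem_nhdsWithin] with ε hε x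
    obtain ⟨γ, h1, h2⟩ := exists_mem_Ico_zpow hε (one_lt_prime (p := p))
    have hp2 : (2 : ℝ) ≤ p := by exact_mod_cast (Fact.out : p.Prime).two_le
    have hp := prime_pos (p := p)
    calc haar p n (Metric.closedBall x (2 * ε)) ≤ haar p n (pball (γ + 1 + 1) x) := by
          refine measure_mono (Metric.closedBall_subset_closedBall ?_)
          rw [zpow_add_one₀ hp.ne' (γ + 1), mul_comm]
          gcongr
      _ = ((p : ℝ≥0∞) ^ n * (p : ℝ≥0∞) ^ n) * haar p n (pball γ x) := by
          rw [haar_pball_succ, haar_pball_succ, mul_assoc]; simp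
      _ ≤ _ := by
          push_cast
          gcongr
          exact Metric.closedBall_subset_closedBall h1

/-- The norm of a nonzero vector of `ℚ_p^n` is an integer power of `p`. -/
lemma exists_norm_eq_zpow {x : Qpn p n} (hx : x ≠ 0) : ∃ γ : ℤ, ‖x‖ = (p : ℝ) ^ γ := by
  have hn : Nonempty (Fin n) := by
    by_contra h
    rw [not_nonempty_iff] at h
    exact hx (Subsingleton.elim _ _)
  obtain ⟨j, hj⟩ := (Finite.exists_max fun j => ‖x j‖)
  have h : ‖x‖ = ‖x j‖ :=
    le_antisymm ((pi_norm_le_iff_of_nonneg (norm_nonneg _)).2 hj) (norm_le_pi_norm x j)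
  have hj0 : x j ≠ 0 := by
    rintro h0
    rw [h0, norm_zero, norm_eq_zero] at h
    exact hx h
  exact ⟨_, h.trans (Padic.norm_eq_zpow_neg_valuation hj0)⟩

end Balls

/-! ### Averages over balls and the weak-type inequality -/

section Maximal

variable {p : ℕ} [Fact p.Prime] {n : ℕ}

/-- The mean of `F` over the ball of radius `p ^ γ` centred at `x`. -/
noncomputable def ballAvg (γ : ℤ) (F : Qpn p n → ℝ≥0∞) (x : Qpn p n) : ℝ≥0∞ :=
  (haar p n (pball γ x))⁻¹ * ∫⁻ y in pball γ x, F y ∂(haar p n)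

/-- The fractional maximal function; `σ = 0` is the Hardy–Littlewood maximal function. -/
noncomputable def fracMax (σ : ℝ) (F : Qpn p n → ℝ≥0∞) (x : Qpn p n) : ℝ≥0∞ :=
  ⨆ γ : ℤ, haar p n (pball γ x) ^ σ * ballAvg γ F x

lemma ballAvg_eq_of_mem {γ δ : ℤ} (h : γ ≤ δ) (F : Qpn p n → ℝ≥0∞) {x y : Qpn p n}
    (hy : y ∈ pball γ x) : ballAvg δ F y = ballAvg δ F x := by
  rw [ballAvg, pball_eq_of_mem (pball_mono h x hy), ballAvg]

/-- Balls are open, so such a function is locally constant. -/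
lemma measurable_of_const_on_pball {E : Type*} [MeasurableSpace E] {γ : ℤ} {g : Qpn p n → E}
    (h : ∀ x, ∀ y ∈ pball γ x, g y = g x) : Measurable g := by
  have : IsLocallyConstant g := by
    rw [IsLocallyConstant.iff_exists_open]
    exact fun x => ⟨pball γ x, isOpen_pball γ x, mem_pball_self γ x, h x⟩
  intro s _
  exact (this s).measurableSet

lemma measurable_ballAvg (γ : ℤ) (F : Qpn p n → ℝ≥0∞) : Measurable (ballAvg γ F) :=
  measurable_of_const_on_pball fun _ _ hy => ballAvg_eq_of_mem le_rfl F hy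

lemma measurable_fracMax (σ : ℝ) (F : Qpn p n → ℝ≥0∞) : Measurable (fracMax σ F) := by
  refine Measurable.iSup fun γ => measurable_of_const_on_pball (γ := γ) fun x y hy => ?_
  simp only [ballAvg_eq_of_mem le_rfl F hy, haar_pball]

lemma ballAvg_mono_ae {γ : ℤ} {F G : Qpn p n → ℝ≥0∞} {x : Qpn p n}
    (h : ∀ᵐ y ∂(haar p n).restrict (pball γ x), F y ≤ G y) : ballAvg γ F x ≤ ballAvg γ G x := by
  exact mul_le_mul_right (lintegral_mono_ae h) _

lemma ballAvg_mono {F G : Qpn p n → ℝ≥0∞} (h : ∀ y, F y ≤ G y) (γ : ℤ) (x : Qpn p n) :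
    ballAvg γ F x ≤ ballAvg γ G x :=
  ballAvg_mono_ae (ae_of_all _ h)

lemma ballAvg_congr_ae {F G : Qpn p n → ℝ≥0∞} (h : F =ᵐ[haar p n] G) (γ : ℤ) (x : Qpn p n) :
    ballAvg γ F x = ballAvg γ G x := by
  unfold ballAvg; rw [lintegral_congr_ae (ae_restrict_of_ae h)]

lemma fracMax_congr_ae {F G : Qpn p n → ℝ≥0∞} (h : F =ᵐ[haar p n] G) (σ : ℝ) :
    fracMax σ F = fracMax σ G := by
  funext x; unfold fracMax; simp_rw [ballAvg_congr_ae h]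

lemma ballAvg_add {F : Qpn p n → ℝ≥0∞} (hF : Measurable F) (G : Qpn p n → ℝ≥0∞)
    (γ : ℤ) (x : Qpn p n) :
    ballAvg γ (fun y => F y + G y) x = ballAvg γ F x + ballAvg γ G x := by
  unfold ballAvg; rw [lintegral_add_left hF, mul_add]

lemma ballAvg_const (c : ℝ≥0∞) (γ : ℤ) (x : Qpn p n) :
    ballAvg γ (fun _ : Qpn p n => c) x = c := by
  unfold ballAvg
  rw [setLIntegral_const, mul_comm, mul_assoc, ENNReal.mul_inv_cancel (haar_pball_ne_zero γ x)
    (haar_pball_ne_top γ x), mul_one]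

lemma ballAvg_const_mul {c : ℝ≥0∞} (hc : c ≠ ∞) (F : Qpn p n → ℝ≥0∞) (γ : ℤ) (x : Qpn p n) :
    ballAvg γ (fun y => c * F y) x = c * ballAvg γ F x := by
  unfold ballAvg; rw [lintegral_const_mul' _ _ hc, mul_left_comm]

lemma fracMax_const_mul {c : ℝ≥0∞} (hc : c ≠ ∞) (F : Qpn p n → ℝ≥0∞) (σ : ℝ) (x : Qpn p n) :
    fracMax σ (fun y => c * F y) x = c * fracMax σ F x := by
  unfold fracMax
  rw [ENNReal.mul_iSup]
  simp_rw [ballAvg_const_mul hc, mul_left_comm]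

lemma fracMax_add_le {F : Qpn p n → ℝ≥0∞} (hF : Measurable F) (G : Qpn p n → ℝ≥0∞)
    (σ : ℝ) (x : Qpn p n) :
    fracMax σ (fun y => F y + G y) x ≤ fracMax σ F x + fracMax σ G x := by
  refine iSup_le fun γ => ?_
  rw [ballAvg_add hF, mul_add]
  exact add_le_add (le_iSup (fun γ => haar p n (pball γ x) ^ σ * ballAvg γ F x) γ)
    (le_iSup (fun γ => haar p n (pball γ x) ^ σ * ballAvg γ G x) γ)

lemma ballAvg_le_fracMax_zero (γ : ℤ) (F : Qpn p n → ℝ≥0∞) (x : Qpn p n) :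
    ballAvg γ F x ≤ fracMax 0 F x := by
  refine le_trans ?_ (le_iSup (fun γ => haar p n (pball γ x) ^ (0 : ℝ) * ballAvg γ F x) γ)
  simp

lemma ballAvg_le_lintegral (γ : ℤ) (F : Qpn p n → ℝ≥0∞) (x : Qpn p n) :
    ballAvg γ F x ≤ (∫⁻ y, F y ∂(haar p n)) / haar p n (pball γ x) := by
  unfold ballAvg; rw [mul_comm, ENNReal.div_eq_inv_mul, mul_comm]
  gcongr; exact Measure.restrict_le_self

/-- The Jensen inequality for means over balls. -/
lemma ballAvg_rpow_le {P : ℝ} (hP : 1 ≤ P) {F : Qpn p n → ℝ≥0∞} (hF : Measurable F)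
    (γ : ℤ) (x : Qpn p n) : ballAvg γ F x ^ P ≤ ballAvg γ (fun y => F y ^ P) x := by
  have : IsProbabilityMeasure
      ((haar p n (pball γ x))⁻¹ • (haar p n).restrict (pball γ x)) := ⟨by
    simp [ENNReal.inv_mul_cancel (haar_pball_ne_zero γ x) (haar_pball_ne_top γ x)]⟩
  have h := eLpNorm'_le_eLpNorm'_of_exponent_le zero_lt_one hP
    ((haar p n (pball γ x))⁻¹ • (haar p n).restrict (pball γ x)) hF.aestronglyMeasurable
  simp only [eLpNorm', enorm_eq_self, ENNReal.rpow_one, lintegral_smul_measure, smul_eq_mul,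
    div_one] at h
  have h2 := ENNReal.rpow_le_rpow h (zero_le_one.trans hP)
  rwa [← ENNReal.rpow_mul, one_div, inv_mul_cancel₀ (by positivity), ENNReal.rpow_one] at h2

/-- Averaging is a conditional expectation and `A` is a union of balls of that scale. The proof is
Tonelli with the symmetry of the relation `y ∈ pball γ x`. -/
lemma setLIntegral_ballAvg_eq {γ : ℤ} {A : Set (Qpn p n)} (hA : MeasurableSet A)
    (hsat : ∀ x ∈ A, pball γ x ⊆ A) {F : Qpn p n → ℝ≥0∞} (hF : Measurable F) :
    ∫⁻ x in A, ballAvg γ F x ∂(haar p n) = ∫⁻ x in A, F x ∂(haar p n) := by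
  have hE : MeasurableSet {z : Qpn p n × Qpn p n | z.2 ∈ pball γ z.1} :=
    (isClosed_le (continuous_snd.dist continuous_fst) continuous_const).measurableSet
  set V := (p : ℝ≥0∞) ^ ((n : ℝ) * γ) with hV
  have hV0 : V ≠ 0 := by rw [hV, ← haar_pball γ (0 : Qpn p n)]; exact haar_pball_ne_zero _ _
  have hV1 : V ≠ ∞ := by rw [hV, ← haar_pball γ (0 : Qpn p n)]; exact haar_pball_ne_top _ _
  have h1 : ∀ x, ballAvg γ F x
      = V⁻¹ * ∫⁻ y, {z : Qpn p n × Qpn p n | z.2 ∈ pball γ z.1}.indicator (fun z => F z.2) (x, y)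
        ∂(haar p n) := by
    intro x
    rw [ballAvg, haar_pball, ← lintegral_indicator (measurableSet_pball γ x)]
    rfl
  have hm : Measurable ({z : Qpn p n × Qpn p n | z.2 ∈ pball γ z.1}.indicator
      (fun z => F z.2)) := (hF.comp measurable_snd).indicator hE
  simp_rw [h1]
  rw [lintegral_const_mul' _ _ (ENNReal.inv_ne_top.2 hV0), lintegral_lintegral_swap (by
    exact hm.aemeasurable), ← lintegral_const_mul' _ _ (ENNReal.inv_ne_top.2 hV0),
    ← lintegral_indicator hA]
  refine lintegral_congr fun y => ?_
  have h2 : ∀ x, {z : Qpn p n × Qpn p n | z.2 ∈ pball γ z.1}.indicator (fun z => F z.2) (x, y)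
      = (pball γ y).indicator (fun _ => F y) x := by
    intro x
    by_cases h : y ∈ pball γ x
    · rw [Set.indicator_of_mem (by exact h), Set.indicator_of_mem (mem_pball_comm.1 h)]
    · rw [Set.indicator_of_notMem (by exact h),
        Set.indicator_of_notMem fun h' => h (mem_pball_comm.1 h')]
  simp_rw [h2]
  rw [lintegral_indicator_const (measurableSet_pball γ y),
    Measure.restrict_apply (measurableSet_pball γ y)]
  by_cases hy : y ∈ A
  · rw [Set.inter_eq_left.2 (hsat y hy), Set.indicator_of_mem hy, haar_pball, ← hV, mul_comm,
      mul_assoc, ENNReal.mul_inv_cancel hV0 hV1, mul_one]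
  · have : pball γ y ∩ A = ∅ := by
      refine Set.eq_empty_of_forall_notMem fun x hx => hy ?_
      exact hsat x hx.2 (mem_pball_comm.1 hx.1)
    rw [this, Set.indicator_of_notMem hy]; simp

/-- The weak-type `(1,1)` inequality for the Hardy–Littlewood maximal function. -/
theorem mul_meas_lt_fracMax_zero_le {F : Qpn p n → ℝ≥0∞} (hF : Measurable F) (t : ℝ≥0∞) :
    t * haar p n {x | t < fracMax 0 F x} ≤ ∫⁻ x, F x ∂(haar p n) := by
  -- Stopping scale: `A N γ` collects the points for which `γ` is the largest scale up to `N` with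
  -- average above `t`. The cutoff `N` guarantees that a largest scale exists; it is removed at the
  -- end by monotone convergence. These sets are disjoint in `γ` and are unions of balls of radius
  -- `p ^ γ`.
  let A : ℤ → ℤ → Set (Qpn p n) := fun N γ =>
    {x | t < ballAvg γ F x ∧ ∀ δ, γ < δ → δ ≤ N → ballAvg δ F x ≤ t}
  let U : ℤ → Set (Qpn p n) := fun N => ⋃ γ : Set.Iic N, A N γ
  have hAm : ∀ N γ, MeasurableSet (A N γ) := by
    intro N γ
    refine (measurableSet_lt measurable_const (measurable_ballAvg γ F)).inter ?_
    have : {x : Qpn p n | ∀ δ, γ < δ → δ ≤ N → ballAvg δ F x ≤ t}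
        = ⋂ δ, ⋂ (_ : γ < δ), ⋂ (_ : δ ≤ N), {x | ballAvg δ F x ≤ t} := by ext; simp
    change MeasurableSet {x : Qpn p n | ∀ δ, γ < δ → δ ≤ N → ballAvg δ F x ≤ t}
    exact this ▸ .iInter fun δ => .iInter fun _ => .iInter fun _ =>
      measurableSet_le (measurable_ballAvg δ F) measurable_const
  have hsat : ∀ N γ, ∀ x ∈ A N γ, pball γ x ⊆ A N γ := by
    intro N γ x hx y hy
    refine ⟨by rw [ballAvg_eq_of_mem le_rfl F hy]; exact hx.1, fun δ hδ hδN => ?_⟩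
    rw [ballAvg_eq_of_mem hδ.le F hy]; exact hx.2 δ hδ hδN
  have hdisj : ∀ N, Pairwise (Function.onFun Disjoint fun γ : Set.Iic N => A N γ) := by
    intro N γ δ hne
    refine Set.disjoint_left.2 fun x hx hy => ?_
    rcases lt_or_gt_of_ne (fun h => hne (Subtype.ext h)) with h | h
    · exact absurd hy.1 (hx.2 δ h δ.2).not_gt
    · exact absurd hx.1 (hy.2 γ h γ.2).not_gt
  have hU : ∀ N, U N = {x | ∃ γ ≤ N, t < ballAvg γ F x} := by
    intro N
    ext x
    simp only [U, Set.mem_iUnion, Set.mem_ofPred_eq]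
    constructor
    · rintro ⟨γ, hγ⟩; exact ⟨γ, γ.2, hγ.1⟩
    · rintro hex
      obtain ⟨m, ⟨hm1, hm2⟩, hm3⟩ := Int.exists_greatest_of_bdd
        (P := fun γ => γ ≤ N ∧ t < ballAvg γ F x) ⟨N, fun _ h => h.1⟩ hex
      exact ⟨⟨m, hm1⟩, hm2, fun δ hδ hδN => not_lt.1 fun h => (hm3 δ ⟨hδN, h⟩).not_gt hδ⟩
  have hbound : ∀ N, t * haar p n (U N) ≤ ∫⁻ x, F x ∂(haar p n) := by
    intro N
    calc t * haar p n (U N) = ∑' γ : Set.Iic N, t * haar p n (A N γ) := by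
          rw [measure_iUnion (hdisj N) fun γ => hAm N γ, ENNReal.tsum_mul_left]
      _ ≤ ∑' γ : Set.Iic N, ∫⁻ x in A N γ, F x ∂(haar p n) := by
          refine ENNReal.tsum_le_tsum fun γ => ?_
          rw [← setLIntegral_ballAvg_eq (hAm N γ) (hsat N γ) hF, ← setLIntegral_const]
          exact setLIntegral_mono (measurable_ballAvg _ F) fun x hx => hx.1.le
      _ = ∫⁻ x in U N, F x ∂(haar p n) :=
          (lintegral_iUnion (fun γ : Set.Iic N => hAm N γ) (hdisj N) F).symm
      _ ≤ _ := setLIntegral_le_lintegral _ _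
  have hUmono : Monotone U := by
    intro N N' h
    rw [hU, hU]
    rintro x ⟨γ, h1, h2⟩
    exact ⟨γ, h1.trans h, h2⟩
  have hset : {x | t < fracMax 0 F x} = ⋃ N, U N := by
    ext x
    simp only [hU, fracMax, ENNReal.rpow_zero, one_mul, Set.mem_ofPred_eq, lt_iSup_iff,
      Set.mem_iUnion]
    exact ⟨fun ⟨γ, h⟩ => ⟨γ, γ, le_rfl, h⟩, fun ⟨_, γ, _, h⟩ => ⟨γ, h⟩⟩
  rw [hset, hUmono.measure_iUnion, ENNReal.mul_iSup]
  exact iSup_le hbound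

end Maximal

/-! ### The maximal theorem for constant exponents -/

section StrongType

variable {p : ℕ} [Fact p.Prime] {n : ℕ}

/-- The part of `F` below `t / 2` contributes at most `t / 2` to each average, so the weak-type
bound is needed only for the rest. Its integral is written as a measure of a superlevel set for `F
dx`, ready for the layer-cake formula. -/
lemma meas_lt_fracMax_zero_le {F : Qpn p n → ℝ≥0∞} (hF : Measurable F) {t : ℝ} (ht : 0 < t) :
    haar p n {x | ENNReal.ofReal t < fracMax 0 F x} ≤
      ENNReal.ofReal (2 / t) *
        (haar p n).withDensity F {x | ENNReal.ofReal (t / 2) < F x} := by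
  set s := ENNReal.ofReal (t / 2) with hs
  have hs0 : s ≠ 0 := by simp [hs, ht]
  have hs1 : s ≠ ∞ := ENNReal.ofReal_ne_top
  have hE : MeasurableSet {x | s < F x} := measurableSet_lt measurable_const hF
  set F₁ := {x | s < F x}.indicator F with hF₁
  have hle : ∀ x, F x ≤ F₁ x + s := by
    intro x
    by_cases h : s < F x
    · rw [hF₁, Set.indicator_of_mem (by exact h)]; exact le_self_add
    · exact (not_lt.1 h).trans le_add_self
  have hsub : {x | ENNReal.ofReal t < fracMax 0 F x} ⊆ {x | s < fracMax 0 F₁ x} := by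
    intro x hx
    obtain ⟨γ, hγ⟩ := lt_iSup_iff.1 (show ENNReal.ofReal t < fracMax 0 F x from hx)
    rw [ENNReal.rpow_zero, one_mul] at hγ
    have h1 : ballAvg γ F x ≤ ballAvg γ F₁ x + s := by
      rw [← ballAvg_const s γ x, ← ballAvg_add (hF.indicator hE)]
      exact ballAvg_mono hle γ x
    have h2 : ENNReal.ofReal t = s + s := by
      rw [hs, ← ENNReal.ofReal_add (by positivity) (by positivity), add_halves]
    rw [h2] at hγ
    have h3 : s < ballAvg γ F₁ x := (ENNReal.add_lt_add_iff_right hs1).1 (hγ.trans_le h1)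
    exact h3.trans_le (ballAvg_le_fracMax_zero γ F₁ x)
  have hinv : ENNReal.ofReal (2 / t) = s⁻¹ := by
    rw [hs, ← ENNReal.ofReal_inv_of_pos (by positivity), inv_div]
  rw [hinv, withDensity_apply _ hE, ← ENNReal.div_eq_inv_mul,
    ENNReal.le_div_iff_mul_le (Or.inl hs0) (Or.inl hs1), mul_comm, ← lintegral_indicator hE]
  exact (mul_le_mul_right (measure_mono hsub) _).trans
    (mul_meas_lt_fracMax_zero_le (hF.indicator hE) s)

/-- The Hardy–Littlewood maximal function is bounded on `L^P` for constant `P > 1`. -/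
theorem exists_lintegral_fracMax_zero_rpow_le {P : ℝ} (hP : 1 < P) :
    ∃ C : ℝ≥0, ∀ F : Qpn p n → ℝ≥0∞, Measurable F →
      ∫⁻ x, fracMax 0 F x ^ P ∂(haar p n) ≤ C * ∫⁻ x, F x ^ P ∂(haar p n) := by
  have hP0 : 0 < P := zero_lt_one.trans hP
  have hP1 : 0 < P - 1 := sub_pos.2 hP
  refine ⟨(P * 2 * (P - 1)⁻¹ * 2 ^ (P - 1)).toNNReal, fun F hF => ?_⟩
  have hC : (((P * 2 * (P - 1)⁻¹ * 2 ^ (P - 1)).toNNReal : ℝ≥0) : ℝ≥0∞) =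
      ENNReal.ofReal P * (ENNReal.ofReal 2 *
        ((ENNReal.ofReal (P - 1))⁻¹ * ENNReal.ofReal (2 ^ (P - 1)))) := by
    rw [← ENNReal.ofReal_inv_of_pos hP1, ← ENNReal.ofReal_mul (by positivity),
      ← ENNReal.ofReal_mul (by positivity), ← ENNReal.ofReal_mul hP0.le]
    simp only [mul_assoc]; rfl
  have hCpos : 0 < P * 2 * (P - 1)⁻¹ * 2 ^ (P - 1) := by positivity
  by_cases hI : ∫⁻ x, F x ^ P ∂(haar p n) = ∞
  · rw [hI, ENNReal.mul_top (by simpa using hCpos)]; exact le_top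
  have hFfin : ∀ᵐ x ∂(haar p n), F x < ∞ := by
    filter_upwards [ae_lt_top (hF.pow_const P) hI] with x hx
    exact (ENNReal.rpow_lt_top_iff_of_pos hP0).1 hx
  set ν := (haar p n).withDensity F with hν
  -- The sets `{t / 2 < F}` are the superlevel sets of `2 F`; the layer-cake formula for `2 F`, with
  -- exponent `P - 1` and measure `F dx`, therefore evaluates the resulting integral in `t`.
  set f : Qpn p n → ℝ := fun x => 2 * (F x).toReal with hf
  have hfm : Measurable f := hF.ennreal_toReal.const_mul 2
  have hfν : ∀ t : ℝ, 0 < t → ν {x | ENNReal.ofReal (t / 2) < F x} = ν {x | t < f x} := by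
    intro t ht
    refine measure_congr (Filter.Eventually.set_eq ?_)
    filter_upwards [(withDensity_absolutelyContinuous _ F).ae_le hFfin] with x hx
    rw [ENNReal.ofReal_lt_iff_lt_toReal (by positivity) hx.ne, hf]
    constructor <;> intro h <;> linarith
  have hf2 : ∫⁻ x, ENNReal.ofReal (f x ^ (P - 1)) ∂ν
      ≤ ENNReal.ofReal (2 ^ (P - 1)) * ∫⁻ x, F x ^ P ∂(haar p n) := by
    rw [hν, lintegral_withDensity_eq_lintegral_mul _ hF (by fun_prop),
      ← lintegral_const_mul' _ _ ENNReal.ofReal_ne_top]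
    refine lintegral_mono_ae ?_
    filter_upwards [hFfin] with x hx
    have h1 : ENNReal.ofReal (f x ^ (P - 1)) = ENNReal.ofReal (2 ^ (P - 1)) * F x ^ (P - 1) := by
      rw [hf, Real.mul_rpow (by norm_num) ENNReal.toReal_nonneg,
        ENNReal.ofReal_mul (by positivity), ENNReal.toReal_rpow,
        ENNReal.ofReal_toReal (ENNReal.rpow_ne_top_of_nonneg hP1.le hx.ne)]
    rw [Pi.mul_apply, h1, mul_left_comm]
    refine mul_le_mul_right (le_of_eq ?_) _
    nth_rewrite 1 [← ENNReal.rpow_one (F x)]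
    rw [← ENNReal.rpow_add_of_nonneg _ _ zero_le_one hP1.le, add_sub_cancel]
  -- Truncation at `N` makes the maximal function real-valued, as the layer-cake formula requires.
  have hmain : ∀ N : ℕ, ∫⁻ x, min (fracMax 0 F x) N ^ P ∂(haar p n)
      ≤ ((P * 2 * (P - 1)⁻¹ * 2 ^ (P - 1)).toNNReal : ℝ≥0) * ∫⁻ x, F x ^ P ∂(haar p n) := by
    intro N
    set g : Qpn p n → ℝ := fun x => (min (fracMax 0 F x) N).toReal with hg
    have hfin : ∀ x, min (fracMax 0 F x) N ≠ ∞ := fun x =>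
      ((min_le_right _ _).trans_lt (ENNReal.natCast_lt_top N)).ne
    have hgm : Measurable g :=
      ((measurable_fracMax 0 F).min measurable_const).ennreal_toReal
    have h1 : ∀ x, min (fracMax 0 F x) N ^ P = ENNReal.ofReal (g x ^ P) := by
      intro x
      rw [hg, ENNReal.toReal_rpow, ENNReal.ofReal_toReal (ENNReal.rpow_ne_top_of_nonneg hP0.le
        (hfin x))]
    simp_rw [h1]
    rw [lintegral_rpow_eq_lintegral_meas_lt_mul _ (ae_of_all _ fun x => ENNReal.toReal_nonneg)
      hgm.aemeasurable hP0, hC, mul_assoc]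
    refine mul_le_mul_right ?_ _
    have h2 := lintegral_rpow_eq_lintegral_meas_lt_mul ν
      (ae_of_all _ fun x => by positivity) hfm.aemeasurable hP1
    have h3 : ∫⁻ t in Set.Ioi (0 : ℝ), ν {a | t < f a} * ENNReal.ofReal (t ^ (P - 1 - 1))
        ≤ (ENNReal.ofReal (P - 1))⁻¹ * ENNReal.ofReal (2 ^ (P - 1)) *
          ∫⁻ x, F x ^ P ∂(haar p n) := by
      rw [mul_assoc]
      refine le_trans (le_of_eq ?_) (mul_le_mul_right hf2 _)
      rw [h2, ← mul_assoc, ENNReal.inv_mul_cancel (by simpa using hP) ENNReal.ofReal_ne_top,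
        one_mul]
    rw [mul_assoc]
    refine le_trans ?_ (mul_le_mul_right (le_trans h3 (le_of_eq (by ring))) _)
    rw [← lintegral_const_mul' _ _ ENNReal.ofReal_ne_top]
    refine setLIntegral_mono' measurableSet_Ioi fun t ht => ?_
    have ht' : 0 < t := ht
    have h4 : haar p n {a | t < g a} ≤ ENNReal.ofReal (2 / t) * ν {x | t < f x} := by
      rw [← hfν t ht']
      refine le_trans (measure_mono fun x hx => ?_) (meas_lt_fracMax_zero_le hF ht')
      exact ((ENNReal.ofReal_lt_iff_lt_toReal ht'.le (hfin x)).2 hx).trans_le (min_le_left _ _)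
    calc _ ≤ ENNReal.ofReal (2 / t) * ν {x | t < f x} * ENNReal.ofReal (t ^ (P - 1)) := by
          gcongr
      _ = ENNReal.ofReal 2 * (ν {x | t < f x} * ENNReal.ofReal (t ^ (P - 1 - 1))) := by
          have : ENNReal.ofReal (2 / t) * ENNReal.ofReal (t ^ (P - 1))
              = ENNReal.ofReal 2 * ENNReal.ofReal (t ^ (P - 1 - 1)) := by
            rw [← ENNReal.ofReal_mul (by positivity), ← ENNReal.ofReal_mul (by positivity),
              Real.rpow_sub_one ht'.ne' (P - 1)]
            congr 1; ring
          rw [mul_right_comm, this]; ring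
  have hlim := lintegral_tendsto_of_tendsto_of_monotone (μ := haar p n)
    (f := fun N : ℕ => fun x => min (fracMax 0 F x) N ^ P) (F := fun x => fracMax 0 F x ^ P)
    (fun N => (((measurable_fracMax 0 F).min measurable_const).pow_const P).aemeasurable)
    (ae_of_all _ fun x N N' h => by dsimp only; gcongr)
    (ae_of_all _ fun x => by
      have : Tendsto (fun N : ℕ => min (fracMax 0 F x) (N : ℝ≥0∞)) atTop
          (𝓝 (min (fracMax 0 F x) ∞)) := tendsto_const_nhds.min ENNReal.tendsto_nat_nhds_top
      rw [min_top_right] at this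
      exact ((ENNReal.continuous_rpow_const (y := P)).tendsto _).comp this)
  exact le_of_tendsto' hlim hmain

end StrongType

/-! ### Consequences of log-Hölder continuity -/

section Exponents

variable {p : ℕ} [Fact p.Prime] {n : ℕ}

lemma IsExponent.one_lt_apply {q : Qpn p n → ℝ} (hq : IsExponent q) (x : Qpn p n) : 1 < q x :=
  hq.one_lt.trans_le (hq.essInf_le x)

lemma IsExponent.pos {q : Qpn p n → ℝ} (hq : IsExponent q) (x : Qpn p n) : 0 < q x :=
  zero_lt_one.trans (hq.one_lt_apply x)

lemma ae_restrict_pball_essInf_le_essSup {q : Qpn p n → ℝ} (hq : IsExponent q) (γ : ℤ)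
    (a : Qpn p n) : ∀ᵐ x ∂(haar p n).restrict (pball γ a),
      essInf q ((haar p n).restrict (pball γ a)) ≤ q x ∧
        q x ≤ essSup q ((haar p n).restrict (pball γ a)) := by
  have h1 : IsBoundedUnder (· ≥ ·) (ae ((haar p n).restrict (pball γ a))) q :=
    isBoundedUnder_of ⟨_, hq.essInf_le⟩
  have h2 : IsBoundedUnder (· ≤ ·) (ae ((haar p n).restrict (pball γ a))) q :=
    isBoundedUnder_of ⟨_, hq.le_essSup⟩
  filter_upwards [ae_essInf_le h1, ae_le_essSup h2] with x hx hy using ⟨hx, hy⟩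

/-- Each ball has a centre in a fixed countable dense set, so there are only countably many balls
and the exceptional null sets can be united. -/
lemma ae_of_forall_ae_restrict_pball {P : ℤ → Set (Qpn p n) → Qpn p n → Prop}
    (h : ∀ γ a, ∀ᵐ x ∂(haar p n).restrict (pball γ a), P γ (pball γ a) x) :
    ∀ᵐ x ∂(haar p n), ∀ γ, P γ (pball γ x) x := by
  have h1 : ∀ᵐ x ∂(haar p n), ∀ γ : ℤ, ∀ k : ℕ,
      x ∈ pball γ (TopologicalSpace.denseSeq (Qpn p n) k) →
        P γ (pball γ (TopologicalSpace.denseSeq (Qpn p n) k)) x := by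
    rw [ae_all_iff]; intro γ
    rw [ae_all_iff]; intro k
    exact (ae_restrict_iff' (measurableSet_pball _ _)).1 (h γ _)
  filter_upwards [h1] with x hx γ
  obtain ⟨k, hk⟩ := (TopologicalSpace.denseRange_denseSeq (Qpn p n)).exists_mem_open
    (isOpen_pball γ x) ⟨x, mem_pball_self γ x⟩
  have := hx γ k (mem_pball_comm.1 hk)
  rwa [pball_eq_of_mem hk] at this

/-- The local log-Hölder condition: on a ball `B` around almost every point `x` the exponent is
bounded below by some `ρ ≤ q x` with `|B| ^ (-(q x - ρ))` bounded independently of `B`. -/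
lemma IsLogHolder.exists_local_bound {q : Qpn p n → ℝ} (hq : IsLogHolder q) :
    ∃ K : ℝ≥0, 1 ≤ K ∧ ∀ᵐ x ∂(haar p n), ∀ γ : ℤ, ∃ ρ, essInf q (haar p n) ≤ ρ ∧ ρ ≤ q x ∧
      (∀ᵐ y ∂(haar p n).restrict (pball γ x), ρ ≤ q y) ∧
        ((haar p n (pball γ x))⁻¹) ^ (q x - ρ) ≤ K := by
  obtain ⟨C, hC, hloc⟩ := hq.loc
  have hp1 := one_le_prime_ennreal (p := p)
  refine ⟨(p : ℝ≥0) ^ ((n : ℝ) * C), NNReal.one_le_rpow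
    (by exact_mod_cast (Fact.out : p.Prime).one_lt.le) (by positivity), ?_⟩
  have hae := ae_of_forall_ae_restrict_pball (P := fun _ B x =>
    essInf q ((haar p n).restrict B) ≤ q x ∧ q x ≤ essSup q ((haar p n).restrict B))
    (ae_restrict_pball_essInf_le_essSup hq.isExponent)
  filter_upwards [hae] with x hx γ
  refine ⟨essInf q ((haar p n).restrict (pball γ x)), ?_, (hx γ).1, ?_, ?_⟩
  · have : NeZero ((haar p n).restrict (pball γ x)) :=
      ⟨fun h => haar_pball_ne_zero γ x (Measure.restrict_eq_zero.1 h)⟩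
    exact le_essInf_of_ae_le _ (ae_of_all _ hq.isExponent.essInf_le)
      (isBoundedUnder_of ⟨_, hq.isExponent.le_essSup⟩ :
        IsBoundedUnder (· ≤ ·) _ q).isCoboundedUnder_ge
  · filter_upwards [ae_restrict_pball_essInf_le_essSup hq.isExponent γ x] with y hy using hy.1
  · set ρ := essInf q ((haar p n).restrict (pball γ x))
    -- The log-Hölder condition matters only for balls of radius at most 1; for `γ ≥ 0` the left
    -- side is nonpositive.
    have hbd : -(γ : ℝ) * (q x - ρ) ≤ C := by
      rcases le_total γ 0 with h | h
      · have h' : (0 : ℝ) ≤ -γ := by exact_mod_cast neg_nonneg.2 h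
        have := mul_le_mul_of_nonneg_left (sub_le_sub_right (hx γ).2 ρ) h'
        linarith [hloc γ x]
      · have h' : (0 : ℝ) ≤ γ := by exact_mod_cast h
        nlinarith [(hx γ).1]
    rw [haar_pball, ← ENNReal.rpow_neg, ← ENNReal.rpow_mul, ENNReal.coe_rpow_of_nonneg _
      (by positivity), ENNReal.coe_natCast]
    refine ENNReal.rpow_le_rpow_of_exponent_le hp1 ?_
    have : (0 : ℝ) ≤ n := by positivity
    nlinarith [mul_le_mul_of_nonneg_left hbd this]

/-- An integrable function which dominates the error terms in the comparison of powers with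
exponents that are close to each other at infinity. -/
noncomputable def decayFun (p : ℕ) [Fact p.Prime] (n : ℕ) (x : Qpn p n) : ℝ≥0∞ :=
  ∑' k : ℕ, (pball (k : ℤ) (0 : Qpn p n)).indicator
    (fun _ => (p : ℝ≥0∞) ^ (-((k : ℝ) * (n + 1)))) x

lemma measurable_decayFun : Measurable (decayFun p n) :=
  Measurable.tsum fun _ => measurable_const.indicator (measurableSet_pball _ _)

lemma lintegral_decayFun_lt_top : ∫⁻ x, decayFun p n x ∂(haar p n) < ∞ := by
  have hp := prime_ennreal_ne_zero (p := p)
  unfold decayFun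
  rw [lintegral_tsum fun _ => (measurable_const.indicator (measurableSet_pball _ _)).aemeasurable]
  have : ∀ k : ℕ, ∫⁻ x, (pball (k : ℤ) (0 : Qpn p n)).indicator
      (fun _ => (p : ℝ≥0∞) ^ (-((k : ℝ) * (n + 1)))) x ∂(haar p n) = ((p : ℝ≥0∞)⁻¹) ^ k := by
    intro k
    rw [lintegral_indicator_const (measurableSet_pball _ _), haar_pball,
      ← ENNReal.rpow_add _ _ hp (ENNReal.natCast_ne_top p), ← ENNReal.rpow_natCast,
      ← ENNReal.rpow_neg_one, ← ENNReal.rpow_mul]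
    congr 1; push_cast; ring
  simp_rw [this]
  rw [ENNReal.tsum_geometric]
  refine ENNReal.inv_lt_top.2 (tsub_pos_of_lt ?_)
  rw [ENNReal.inv_lt_one]
  exact_mod_cast (Fact.out : p.Prime).one_lt

/-- Dichotomy in `t`: if `t` is below the term of `decayFun` at the scale of `y`, the error absorbs
`t ^ a ≤ t`; otherwise `t` is at least a fixed negative power of that scale, and `t ^ (a - b)` is
bounded because `|a - b|` is at most the inverse logarithm of the scale, up to a constant. -/
lemma exists_rpow_le_rpow_add_decayFun (C : ℝ) :
    ∃ K : ℝ≥0, 1 ≤ K ∧ ∀ (y : Qpn p n) (t : ℝ≥0∞) (a b : ℝ), t ≤ 1 → 1 ≤ a →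
      |a - b| ≤ C / Real.logb p (p + ‖y‖) → t ^ a ≤ K * t ^ b + decayFun p n y := by
  have hp1 := one_le_prime_ennreal (p := p)
  have hpr := one_lt_prime (p := p)
  have hp0 := prime_pos (p := p)
  refine ⟨(p : ℝ≥0) ^ (2 * |C| * (n + 1)), NNReal.one_le_rpow
    (by exact_mod_cast (Fact.out : p.Prime).one_lt.le) (by positivity), ?_⟩
  intro y t a b ht ha hab
  set L := Real.logb p (p + ‖y‖) with hL
  have hpy : 0 < p + ‖y‖ := by positivity
  have hL1 : 1 ≤ L := by
    rw [hL, Real.le_logb_iff_rpow_le hpr hpy, Real.rpow_one]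
    linarith [norm_nonneg y]
  -- The index of a ball around 0 that contains `y`. Since `L ≥ 1`, rounding up at most doubles `L`,
  -- which is the source of the factor 2 in the constant.
  set k := ⌈L⌉₊ with hk
  have hk1 : (k : ℝ) ≤ 2 * L := by linarith [Nat.ceil_lt_add_one (zero_le_one.trans hL1)]
  have hkab : (k : ℝ) * |a - b| ≤ 2 * |C| := by
    have h1 : |a - b| ≤ |C| / L := hab.trans (by gcongr; exact le_abs_self C)
    rw [le_div_iff₀ (by linarith)] at h1
    nlinarith [abs_nonneg (a - b)]
  have hmem : y ∈ pball (k : ℤ) (0 : Qpn p n) := by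
    rw [mem_pball, sub_zero, zpow_natCast, ← Real.rpow_natCast]
    have := (Real.logb_le_iff_le_rpow hpr hpy).1 (Nat.le_ceil L)
    linarith
  have hterm : (p : ℝ≥0∞) ^ (-((k : ℝ) * (n + 1))) ≤ decayFun p n y := by
    have := ENNReal.le_tsum (f := fun k : ℕ => (pball (k : ℤ) (0 : Qpn p n)).indicator
      (fun _ => (p : ℝ≥0∞) ^ (-((k : ℝ) * (n + 1)))) y) k
    rwa [Set.indicator_of_mem hmem] at this
  rcases le_total t ((p : ℝ≥0∞) ^ (-((k : ℝ) * (n + 1)))) with h | h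
  · have : t ^ a ≤ t := by
      simpa using ENNReal.rpow_le_rpow_of_exponent_ge ht ha
    exact (this.trans (h.trans hterm)).trans le_add_self
  · refine le_add_of_le_left ?_
    have ht0 : t ≠ 0 := by
      intro h0
      rw [h0, nonpos_iff_eq_zero, ENNReal.rpow_eq_zero_iff] at h
      rcases h with h | h
      · exact prime_ennreal_ne_zero h.1
      · exact ENNReal.natCast_ne_top p h.1
    have htt : t ≠ ∞ := (ht.trans_lt ENNReal.one_lt_top).ne
    have h1 : t ^ a = t ^ (a - b) * t ^ b := by
      rw [← ENNReal.rpow_add _ _ ht0 htt, sub_add_cancel]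
    rw [h1]
    refine mul_le_mul_left ?_ _
    rw [ENNReal.coe_rpow_of_nonneg _ (by positivity), ENNReal.coe_natCast]
    calc t ^ (a - b) ≤ t ^ (-|a - b|) :=
          ENNReal.rpow_le_rpow_of_exponent_ge ht (neg_abs_le _)
      _ ≤ ((p : ℝ≥0∞) ^ (-((k : ℝ) * (n + 1)))) ^ (-|a - b|) := by
          rw [ENNReal.rpow_neg, ENNReal.rpow_neg, ENNReal.inv_le_inv]
          exact ENNReal.rpow_le_rpow h (abs_nonneg _)
      _ = (p : ℝ≥0∞) ^ ((k : ℝ) * |a - b| * (n + 1)) := by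
          rw [← ENNReal.rpow_mul]; congr 1; ring
      _ ≤ _ := by
          refine ENNReal.rpow_le_rpow_of_exponent_le hp1 ?_
          gcongr

/-- Two exponents `r`, `q` of class `𝒞^log` with `1 / q = 1 / r - σ` have limits at infinity, which
satisfy the same relation, and powers with variable exponents below `1` are comparable with those
of the limit exponents up to an integrable error. -/
lemma exists_limit_exponents (hn : n ≠ 0) {r q : Qpn p n → ℝ} (hr : IsLogHolder r)
    (hq : IsLogHolder q) {σ : ℝ} (hrel : ∀ x, 1 / q x = 1 / r x - σ) :
    ∃ (r₀ q₀ : ℝ) (K : ℝ≥0), 1 < r₀ ∧ 1 < q₀ ∧ 1 / q₀ = 1 / r₀ - σ ∧ 1 ≤ K ∧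
      ∀ (y : Qpn p n) (t : ℝ≥0∞), t ≤ 1 →
        t ^ r y ≤ K * t ^ r₀ + decayFun p n y ∧ t ^ r₀ ≤ K * t ^ r y + decayFun p n y ∧
        t ^ q y ≤ K * t ^ q₀ + decayFun p n y ∧ t ^ q₀ ≤ K * t ^ q y + decayFun p n y := by
  have : Nonempty (Fin n) := ⟨⟨0, Nat.pos_of_ne_zero hn⟩⟩
  have hseq : ∀ k : ℕ, ∃ x : Qpn p n, (k : ℝ) < ‖x‖ := by
    intro k
    obtain ⟨c, hc⟩ := NormedField.exists_lt_norm ℚ_[p] k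
    exact ⟨fun _ => c, by rwa [pi_norm_const]⟩
  choose x hx using hseq
  -- A common subsequence for both exponents, so that their relation passes to the limits.
  obtain ⟨⟨r₀, q₀⟩, hmem, φ, hφ, hlim⟩ := (isCompact_Icc.prod isCompact_Icc).tendsto_subseq
    (s := Set.Icc (essInf r (haar p n)) (essSup r (haar p n)) ×ˢ
      Set.Icc (essInf q (haar p n)) (essSup q (haar p n)))
    (x := fun k => (r (x k), q (x k))) (fun k =>
      ⟨⟨hr.isExponent.essInf_le _, hr.isExponent.le_essSup _⟩,
        ⟨hq.isExponent.essInf_le _, hq.isExponent.le_essSup _⟩⟩)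
  have hlr : Tendsto (fun k => r (x (φ k))) atTop (𝓝 r₀) :=
    (continuous_fst.tendsto _).comp hlim
  have hlq : Tendsto (fun k => q (x (φ k))) atTop (𝓝 q₀) :=
    (continuous_snd.tendsto _).comp hlim
  have hr₀ : 1 < r₀ := hr.isExponent.one_lt.trans_le hmem.1.1
  have hq₀ : 1 < q₀ := hq.isExponent.one_lt.trans_le hmem.2.1
  have hrel₀ : 1 / q₀ = 1 / r₀ - σ := by
    have h1 : Tendsto (fun k => 1 / q (x (φ k))) atTop (𝓝 (1 / q₀)) :=
      tendsto_const_nhds.div hlq (by positivity)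
    have h2 : Tendsto (fun k => 1 / r (x (φ k)) - σ) atTop (𝓝 (1 / r₀ - σ)) :=
      (tendsto_const_nhds.div hlr (by positivity)).sub_const σ
    simp_rw [hrel] at h1
    exact tendsto_nhds_unique h1 h2
  have key : ∀ (s : Qpn p n → ℝ) (s₀ C : ℝ), Tendsto (fun k => s (x (φ k))) atTop (𝓝 s₀) →
      (∀ x y : Qpn p n, |s x - s y| ≤ C / Real.logb p (p + min ‖x‖ ‖y‖)) →
      ∀ y, |s y - s₀| ≤ C / Real.logb p (p + ‖y‖) := by
    intro s s₀ C hs h y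
    refine le_of_tendsto (tendsto_const_nhds.sub hs).abs ?_
    filter_upwards [eventually_ge_atTop ⌈‖y‖⌉₊] with k hk
    have h1 : ‖y‖ ≤ ‖x (φ k)‖ :=
      (Nat.le_ceil _).trans ((Nat.cast_le.2 (hk.trans (hφ.id_le k))).trans (hx _).le)
    simpa [min_eq_left h1] using h y (x (φ k))
  obtain ⟨C₁, _, h₁⟩ := hr.infty
  obtain ⟨C₂, _, h₂⟩ := hq.infty
  obtain ⟨K₁, hK₁, hp₁⟩ := exists_rpow_le_rpow_add_decayFun (p := p) (n := n) C₁
  obtain ⟨K₂, hK₂, hp₂⟩ := exists_rpow_le_rpow_add_decayFun (p := p) (n := n) C₂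
  have d₁ := key r r₀ C₁ hlr h₁
  have d₂ := key q q₀ C₂ hlq h₂
  refine ⟨r₀, q₀, max K₁ K₂, hr₀, hq₀, hrel₀, hK₁.trans (le_max_left _ _), fun y t ht => ?_⟩
  have m₁ : (K₁ : ℝ≥0∞) ≤ (max K₁ K₂ : ℝ≥0) := ENNReal.coe_le_coe.2 (le_max_left _ _)
  have m₂ : (K₂ : ℝ≥0∞) ≤ (max K₁ K₂ : ℝ≥0) := ENNReal.coe_le_coe.2 (le_max_right _ _)
  refine ⟨(hp₁ y t _ _ ht (hr.isExponent.one_lt_apply y).le (d₁ y)).trans ?_,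
    (hp₁ y t _ _ ht hr₀.le ((abs_sub_comm _ _).trans_le (d₁ y))).trans ?_,
    (hp₂ y t _ _ ht (hq.isExponent.one_lt_apply y).le (d₂ y)).trans ?_,
    (hp₂ y t _ _ ht hq₀.le ((abs_sub_comm _ _).trans_le (d₂ y))).trans ?_⟩ <;> gcongr

end Exponents

/-! ### The fractional maximal function on variable Lebesgue spaces -/

section FractionalMaximal

/-- Hedberg's trick: the relation between the exponents reads `q = r σ q + r`, so `A ^ q = (A ^ r) ^
(σ q) * A ^ r`, and the bound on the first factor cancels `V ^ (σ q)`. -/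
lemma mul_rpow_le_of_rpow_le_div {V A : ℝ≥0∞} (hV0 : V ≠ 0) (hV : V ≠ ∞) {K : ℝ≥0∞} {r q σ : ℝ}
    (hr : 0 < r) (hq : 0 < q) (hσ : 0 ≤ σ) (hrel : 1 / q = 1 / r - σ) (hA : A ^ r ≤ K / V) :
    (V ^ σ * A) ^ q ≤ K ^ (σ * q) * A ^ r := by
  have hσq : 0 ≤ σ * q := by positivity
  have h1 : q = r * (σ * q) + r := by
    field_simp at hrel
    linarith
  have h2 : A ^ q = (A ^ r) ^ (σ * q) * A ^ r := by
    nth_rewrite 1 [h1]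
    rw [ENNReal.rpow_add_of_nonneg _ _ (by positivity) hr.le, ENNReal.rpow_mul]
  rw [ENNReal.mul_rpow_of_nonneg _ _ hq.le, ← ENNReal.rpow_mul, h2, ← mul_assoc]
  refine mul_le_mul_left ?_ _
  rw [← ENNReal.mul_rpow_of_nonneg _ _ hσq]
  refine ENNReal.rpow_le_rpow ((mul_le_mul_right hA V).trans_eq ?_) hσq
  exact ENNReal.mul_div_cancel hV0 hV

variable {p : ℕ} [Fact p.Prime] {n : ℕ}

/-- Let `m` be the essential infimum of `r`. Jensen with exponent `ρ / m` applies, and since `F` is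
0 or at least 1 that exponent may be raised to `r y / m`. The modular bound gives `G ^ m ≤ 1 / |B|`
for the resulting average `G`, so passing from `ρ` to `r x` costs at most `|B| ^ (-(r x - ρ) / ρ) ≤
K`. -/
lemma ballAvg_rpow_le_of_local_bound {r : Qpn p n → ℝ} (hr : IsExponent r) {K : ℝ≥0} (hK : 1 ≤ K)
    {F : Qpn p n → ℝ≥0∞} (hF : Measurable F) (hF1 : ∀ y, F y = 0 ∨ 1 ≤ F y)
    (hFr : ∫⁻ y, F y ^ r y ∂(haar p n) ≤ 1) {γ : ℤ} {x : Qpn p n} {ρ : ℝ}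
    (hρ : essInf r (haar p n) ≤ ρ) (hρx : ρ ≤ r x)
    (hρy : ∀ᵐ y ∂(haar p n).restrict (pball γ x), ρ ≤ r y)
    (hV : ((haar p n (pball γ x))⁻¹) ^ (r x - ρ) ≤ K) :
    ballAvg γ F x ^ r x ≤ K * ballAvg γ (fun y => F y ^ (r y / essInf r (haar p n))) x ^
        essInf r (haar p n) ∧
      ballAvg γ F x ^ r x ≤ K / haar p n (pball γ x) := by
  set m := essInf r (haar p n) with hm
  have hm0 : 0 < m := zero_lt_one.trans hr.one_lt
  have hρ0 : 0 < ρ := hm0.trans_le hρ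
  have hρ1 : 1 ≤ ρ := hr.one_lt.le.trans hρ
  set G := ballAvg γ (fun y => F y ^ (r y / m)) x with hG
  have hGm : G ^ m ≤ (haar p n (pball γ x))⁻¹ := by
    refine (ballAvg_rpow_le hr.one_lt.le (hF.pow (hr.measurable.div_const m)) γ x).trans ?_
    have hpow : ∀ y, (F y ^ (r y / m)) ^ m = F y ^ r y := fun y => by
      rw [← ENNReal.rpow_mul, div_mul_cancel₀ _ hm0.ne']
    refine (le_of_eq (congrArg (fun f => ballAvg γ f x) (funext hpow))).trans ?_
    refine (ballAvg_le_lintegral _ _ _).trans ?_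
    rw [← one_div]
    gcongr
  have hA : ballAvg γ F x ^ ρ ≤ G ^ m := by
    have h1 : ballAvg γ F x ^ (ρ / m) ≤ G := by
      refine (ballAvg_rpow_le ((one_le_div hm0).2 hρ) hF γ x).trans (ballAvg_mono_ae ?_)
      filter_upwards [hρy] with y hy
      rcases hF1 y with h | h
      · rw [h, ENNReal.zero_rpow_of_pos (by positivity)]; exact zero_le
      · exact ENNReal.rpow_le_rpow_of_exponent_le h (by gcongr)
    have h2 := ENNReal.rpow_le_rpow h1 hm0.le
    rwa [← ENNReal.rpow_mul, div_mul_cancel₀ _ hm0.ne'] at h2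
  have hmain : ballAvg γ F x ^ r x ≤ K * G ^ m := by
    have he : 0 ≤ (r x - ρ) / ρ := div_nonneg (sub_nonneg.2 hρx) hρ0.le
    have hsplit : r x = ρ * (1 + (r x - ρ) / ρ) := by field_simp; ring
    calc ballAvg γ F x ^ r x = (ballAvg γ F x ^ ρ) ^ (1 + (r x - ρ) / ρ) := by
          rw [← ENNReal.rpow_mul, ← hsplit]
      _ ≤ (G ^ m) ^ (1 + (r x - ρ) / ρ) := by gcongr
      _ = G ^ m * (G ^ m) ^ ((r x - ρ) / ρ) := by
          rw [ENNReal.rpow_add_of_nonneg _ _ zero_le_one he, ENNReal.rpow_one]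
      _ ≤ G ^ m * K := by
          refine mul_le_mul_right ?_ _
          calc (G ^ m) ^ ((r x - ρ) / ρ)
              ≤ ((haar p n (pball γ x))⁻¹) ^ ((r x - ρ) / ρ) := by gcongr
            _ = (((haar p n (pball γ x))⁻¹) ^ (r x - ρ)) ^ (1 / ρ) := by
                rw [← ENNReal.rpow_mul]; congr 1; ring
            _ ≤ (K : ℝ≥0∞) ^ (1 / ρ) := by gcongr
            _ ≤ (K : ℝ≥0∞) ^ (1 : ℝ) :=
                ENNReal.rpow_le_rpow_of_exponent_le (by exact_mod_cast hK)
                  ((div_le_one hρ0).2 hρ1)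
            _ = K := ENNReal.rpow_one _
      _ = K * G ^ m := mul_comm _ _
  exact ⟨hmain, hmain.trans (mul_le_mul_right hGm _)⟩

/-- With `m` the essential infimum of `r` and `G = F ^ (r / m)`, the integral of `G ^ m` is the
modular of `F`; the maximal theorem for the constant exponent `m > 1` is applied to `G`. -/
lemma exists_lintegral_fracMax_rpow_le_of_large {r q : Qpn p n → ℝ} (hr : IsLogHolder r)
    (hq : IsExponent q) {σ : ℝ} (hσ : 0 ≤ σ) (hrel : ∀ x, 1 / q x = 1 / r x - σ) :
    ∃ C : ℝ≥0, ∀ F : Qpn p n → ℝ≥0∞, Measurable F → (∀ y, F y = 0 ∨ 1 ≤ F y) →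
      ∫⁻ y, F y ^ r y ∂(haar p n) ≤ 1 → ∫⁻ x, fracMax σ F x ^ q x ∂(haar p n) ≤ C := by
  obtain ⟨K, hK, hloc⟩ := hr.exists_local_bound
  have hre := hr.isExponent
  set m := essInf r (haar p n) with hm
  have hm0 : 0 < m := zero_lt_one.trans hre.one_lt
  obtain ⟨C, hC⟩ := exists_lintegral_fracMax_zero_rpow_le (p := p) (n := n) hre.one_lt
  have hQ : 0 ≤ σ * essSup q (haar p n) :=
    mul_nonneg hσ ((hq.pos 0).le.trans (hq.le_essSup 0))
  refine ⟨K ^ (σ * essSup q (haar p n)) * K * C, fun F hF hF1 hFr => ?_⟩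
  set G : Qpn p n → ℝ≥0∞ := fun y => F y ^ (r y / m) with hG
  have hGm : Measurable G := hF.pow (hre.measurable.div_const m)
  have hpt : ∀ᵐ x ∂(haar p n), fracMax σ F x ^ q x ≤
      ((K ^ (σ * essSup q (haar p n)) * K : ℝ≥0) : ℝ≥0∞) * fracMax 0 G x ^ m := by
    filter_upwards [hloc] with x hx
    -- The power is moved to the other side so that the supremum can be bounded ball by ball.
    rw [← ENNReal.le_rpow_inv_iff (hq.pos x)]
    refine iSup_le fun γ => ?_
    rw [ENNReal.le_rpow_inv_iff (hq.pos x)]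
    obtain ⟨ρ, h1, h2, h3, h4⟩ := hx γ
    obtain ⟨h5, h6⟩ := ballAvg_rpow_le_of_local_bound hre hK hF hF1 hFr h1 h2 h3 h4
    have hK' : (1 : ℝ≥0∞) ≤ K := by exact_mod_cast hK
    calc _ ≤ (K : ℝ≥0∞) ^ (σ * q x) * ballAvg γ F x ^ r x :=
          mul_rpow_le_of_rpow_le_div (haar_pball_ne_zero γ x) (haar_pball_ne_top γ x)
            (hre.pos x) (hq.pos x) hσ (hrel x) h6
      _ ≤ (K : ℝ≥0∞) ^ (σ * essSup q (haar p n)) * (K * fracMax 0 G x ^ m) := by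
          refine mul_le_mul' (ENNReal.rpow_le_rpow_of_exponent_le hK'
            (mul_le_mul_of_nonneg_left (hq.le_essSup x) hσ)) (h5.trans ?_)
          exact mul_le_mul_right
            (ENNReal.rpow_le_rpow (ballAvg_le_fracMax_zero γ G x) hm0.le) _
      _ = _ := by
          rw [ENNReal.coe_mul, ENNReal.coe_rpow_of_nonneg _ hQ, mul_assoc]
  calc _ ≤ ∫⁻ x, ((K ^ (σ * essSup q (haar p n)) * K : ℝ≥0) : ℝ≥0∞) * fracMax 0 G x ^ m
        ∂(haar p n) := lintegral_mono_ae hpt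
    _ ≤ ((K ^ (σ * essSup q (haar p n)) * K : ℝ≥0) : ℝ≥0∞) * (C * 1) := by
        rw [lintegral_const_mul' _ _ ENNReal.coe_ne_top]
        refine mul_le_mul_right ((hC G hGm).trans (mul_le_mul_right ?_ _)) _
        refine le_trans (le_of_eq (lintegral_congr fun y => ?_)) hFr
        rw [hG, ← ENNReal.rpow_mul, div_mul_cancel₀ _ hm0.ne']
    _ = _ := by rw [mul_one, ENNReal.coe_mul (_ * _)]

/-- Replacing `r` and `q` by their limits `r₀` and `q₀` costs an integrable error, which reduces the
bound to Hedberg's inequality and the maximal theorem on `L^{r₀}`. -/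
lemma exists_lintegral_fracMax_rpow_le_of_small (hn : n ≠ 0) {r q : Qpn p n → ℝ}
    (hr : IsLogHolder r) (hq : IsLogHolder q) {σ : ℝ} (hσ : 0 ≤ σ)
    (hrel : ∀ x, 1 / q x = 1 / r x - σ) :
    ∃ C : ℝ≥0, ∀ F : Qpn p n → ℝ≥0∞, Measurable F → (∀ y, F y ≤ 1) →
      ∫⁻ y, F y ^ r y ∂(haar p n) ≤ 1 → ∫⁻ x, fracMax σ F x ^ q x ∂(haar p n) ≤ C := by
  obtain ⟨r₀, q₀, K, hr₀, hq₀, hrel₀, hK, hcmp⟩ := exists_limit_exponents hn hr hq hrel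
  have hr₀' : 0 < r₀ := zero_lt_one.trans hr₀
  have hq₀' : 0 < q₀ := zero_lt_one.trans hq₀
  obtain ⟨C, hC⟩ := exists_lintegral_fracMax_zero_rpow_le (p := p) (n := n) hr₀
  obtain ⟨H, hH⟩ := ENNReal.lt_iff_exists_coe.1 (lintegral_decayFun_lt_top (p := p) (n := n))
  have hH := hH.1
  set K₁ : ℝ≥0 := K + H with hK₁
  have hK₁1 : 1 ≤ K₁ := hK.trans le_self_add
  -- The constant of Hedberg's inequality. Division by it brings the fractional maximal function
  -- below 1, where powers with exponents `q x` and `q₀` are comparable.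
  set L : ℝ≥0 := (K₁ ^ (σ * q₀)) ^ (1 / q₀) with hL
  have hL1 : 1 ≤ L :=
    NNReal.one_le_rpow (NNReal.one_le_rpow hK₁1 (by positivity)) (by positivity)
  have hL0 : (L : ℝ≥0∞) ≠ 0 := by
    simpa using (zero_lt_one.trans_le hL1).ne'
  have hLq : (L : ℝ≥0∞) ^ q₀ = (K₁ : ℝ≥0∞) ^ (σ * q₀) := by
    rw [← ENNReal.coe_rpow_of_nonneg _ hq₀'.le, hL, ← NNReal.rpow_mul,
      one_div_mul_cancel hq₀'.ne', NNReal.rpow_one,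
      ENNReal.coe_rpow_of_nonneg _ (by positivity)]
  set Q := essSup q (haar p n) with hQ
  have hQ0 : 0 ≤ Q := (hq.isExponent.pos 0).le.trans (hq.isExponent.le_essSup 0)
  refine ⟨L ^ Q * (K * (C * K₁) + H), fun F hF hF1 hFr => ?_⟩
  have hFr₀ : ∫⁻ y, F y ^ r₀ ∂(haar p n) ≤ K₁ := by
    calc _ ≤ ∫⁻ y, (K * F y ^ r y + decayFun p n y) ∂(haar p n) :=
          lintegral_mono fun y => (hcmp y (F y) (hF1 y)).2.1
      _ = K * ∫⁻ y, F y ^ r y ∂(haar p n) + H := by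
          rw [lintegral_add_right _ measurable_decayFun, hH,
            lintegral_const_mul' _ _ ENNReal.coe_ne_top]
      _ ≤ K * 1 + H := by gcongr
      _ = K₁ := by rw [mul_one, hK₁, ENNReal.coe_add]
  have hMle : ∀ x, fracMax 0 F x ≤ 1 := by
    intro x
    refine iSup_le fun γ => ?_
    rw [ENNReal.rpow_zero, one_mul]
    exact (ballAvg_mono hF1 γ x).trans_eq (ballAvg_const 1 γ x)
  have hS : ∀ x, fracMax σ F x / L ≤ fracMax 0 F x ^ (r₀ / q₀) := by
    intro x
    rw [ENNReal.div_le_iff hL0 ENNReal.coe_ne_top]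
    refine iSup_le fun γ => ?_
    rw [← ENNReal.rpow_le_rpow_iff hq₀', ENNReal.mul_rpow_of_nonneg (_ ^ (r₀ / q₀)) _ hq₀'.le,
      ← ENNReal.rpow_mul, div_mul_cancel₀ _ hq₀'.ne', hLq]
    have hA : ballAvg γ F x ^ r₀ ≤ K₁ / haar p n (pball γ x) := by
      refine (ballAvg_rpow_le hr₀.le hF γ x).trans ((ballAvg_le_lintegral _ _ _).trans ?_)
      gcongr
    refine (mul_rpow_le_of_rpow_le_div (haar_pball_ne_zero γ x) (haar_pball_ne_top γ x)
            hr₀' hq₀' hσ hrel₀ hA).trans ?_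
    rw [mul_comm]
    gcongr
    exact ballAvg_le_fracMax_zero γ F x
  have hS1 : ∀ x, fracMax σ F x / L ≤ 1 := fun x =>
    (hS x).trans (ENNReal.rpow_le_one (hMle x) (by positivity))
  have hpt : ∀ x, fracMax σ F x ^ q x ≤
      (L : ℝ≥0∞) ^ Q * (K * fracMax 0 F x ^ r₀ + decayFun p n x) := by
    intro x
    calc fracMax σ F x ^ q x = (L : ℝ≥0∞) ^ q x * (fracMax σ F x / L) ^ q x := by
          rw [← ENNReal.mul_rpow_of_nonneg _ _ (hq.isExponent.pos x).le,
            ENNReal.mul_div_cancel hL0 ENNReal.coe_ne_top]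
      _ ≤ (L : ℝ≥0∞) ^ Q * (K * (fracMax σ F x / L) ^ q₀ + decayFun p n x) :=
          mul_le_mul' (ENNReal.rpow_le_rpow_of_exponent_le (by exact_mod_cast hL1)
            (hq.isExponent.le_essSup x)) (hcmp x _ (hS1 x)).2.2.1
      _ ≤ _ := by
          gcongr
          refine (ENNReal.rpow_le_rpow (hS x) hq₀'.le).trans_eq ?_
          rw [← ENNReal.rpow_mul, div_mul_cancel₀ _ hq₀'.ne']
  calc _ ≤ ∫⁻ x, (L : ℝ≥0∞) ^ Q * (K * fracMax 0 F x ^ r₀ + decayFun p n x) ∂(haar p n) :=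
        lintegral_mono hpt
    _ = (L : ℝ≥0∞) ^ Q * (K * ∫⁻ x, fracMax 0 F x ^ r₀ ∂(haar p n) + H) := by
        rw [lintegral_const_mul' _ _ (ENNReal.rpow_ne_top_of_nonneg hQ0 ENNReal.coe_ne_top),
          lintegral_add_right _ measurable_decayFun, hH,
          lintegral_const_mul' _ _ ENNReal.coe_ne_top]
    _ ≤ (L : ℝ≥0∞) ^ Q * (K * (C * K₁) + H) := by
        gcongr
        exact (hC F hF).trans (by gcongr)
    _ = _ := by
        rw [← ENNReal.coe_rpow_of_nonneg _ hQ0]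
        push_cast
        rfl

/-- The fractional maximal function is bounded from `L^{r(·)}` to `L^{q(·)}`, in modular form. -/
theorem exists_lintegral_fracMax_div_rpow_le_one (hn : n ≠ 0) {r q : Qpn p n → ℝ}
    (hr : IsLogHolder r) (hq : IsLogHolder q) {σ : ℝ} (hσ : 0 ≤ σ)
    (hrel : ∀ x, 1 / q x = 1 / r x - σ) :
    ∃ C : ℝ≥0, 0 < C ∧ ∀ F : Qpn p n → ℝ≥0∞, AEMeasurable F (haar p n) →
      ∫⁻ y, F y ^ r y ∂(haar p n) ≤ 1 → ∫⁻ x, (fracMax σ F x / C) ^ q x ∂(haar p n) ≤ 1 := by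
  obtain ⟨C₁, h₁⟩ := exists_lintegral_fracMax_rpow_le_of_large hr hq.isExponent hσ hrel
  obtain ⟨C₂, h₂⟩ := exists_lintegral_fracMax_rpow_le_of_small hn hr hq hσ hrel
  set Q := essSup q (haar p n) with hQ
  have hQ1 : 1 ≤ Q := (hq.isExponent.one_lt_apply 0).le.trans (hq.isExponent.le_essSup 0)
  -- The summand 1 gives `C ≥ 1`, hence `C⁻¹ ^ q x ≤ C⁻¹`; the factor `2 ^ (Q - 1)` comes from
  -- convexity when the large and small parts are added.
  set C : ℝ≥0 := 1 + 2 ^ (Q - 1) * (C₁ + C₂) with hCdef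
  have hC1 : (1 : ℝ≥0∞) ≤ C := by exact_mod_cast le_self_add
  have hC0 : (C : ℝ≥0∞) ≠ 0 := (zero_lt_one.trans_le hC1).ne'
  refine ⟨C, by simpa using zero_lt_one.trans_le hC1, fun F' hF' hFr' => ?_⟩
  obtain ⟨F, hF, hFF⟩ := hF'
  rw [fracMax_congr_ae hFF]
  have hFr : ∫⁻ y, F y ^ r y ∂(haar p n) ≤ 1 := by
    refine le_trans (le_of_eq (lintegral_congr_ae ?_)) hFr'
    filter_upwards [hFF] with y hy using by rw [hy]
  have hE : MeasurableSet {y | 1 ≤ F y} := measurableSet_le measurable_const hF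
  set F₁ := {y | 1 ≤ F y}.indicator F
  set F₂ := {y | 1 ≤ F y}ᶜ.indicator F
  have hle₁ : ∀ y, F₁ y ≤ F y := Set.indicator_le_self _ _
  have hle₂ : ∀ y, F₂ y ≤ F y := Set.indicator_le_self _ _
  have hsum : (fun y => F₁ y + F₂ y) = F :=
    Set.indicator_self_add_compl {y | 1 ≤ F y} F
  have hb₁ := h₁ F₁ (hF.indicator hE) (fun y => by
    by_cases h : 1 ≤ F y
    · right; rwa [show F₁ y = F y from Set.indicator_of_mem (by exact h) _]
    · left; exact Set.indicator_of_notMem (by exact h) _)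
    ((lintegral_mono fun y => ENNReal.rpow_le_rpow (hle₁ y)
      (hr.isExponent.pos y).le).trans hFr)
  have hb₂ := h₂ F₂ (hF.indicator hE.compl) (fun y => by
    by_cases h : 1 ≤ F y
    · rw [show F₂ y = 0 from Set.indicator_of_notMem 
          (Set.notMem_compl_iff.2 (show y ∈ {y | 1 ≤ F y} from h)) _]
      exact zero_le_one
    · exact (hle₂ y).trans (not_le.1 h).le)
    ((lintegral_mono fun y => ENNReal.rpow_le_rpow (hle₂ y)
      (hr.isExponent.pos y).le).trans hFr)
  have hpt : ∀ x, (fracMax σ F x / C) ^ q x ≤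
      (2 ^ (Q - 1) * (fracMax σ F₁ x ^ q x + fracMax σ F₂ x ^ q x)) * (C : ℝ≥0∞)⁻¹ := by
    intro x
    rw [div_eq_mul_inv, ENNReal.mul_rpow_of_nonneg _ _ (hq.isExponent.pos x).le]
    refine mul_le_mul' ?_ ?_
    · calc fracMax σ F x ^ q x ≤ (fracMax σ F₁ x + fracMax σ F₂ x) ^ q x := by
            refine ENNReal.rpow_le_rpow ?_ (hq.isExponent.pos x).le
            rw [← hsum]
            exact fracMax_add_le (hF.indicator hE) _ _ _
        _ ≤ 2 ^ (q x - 1) * (fracMax σ F₁ x ^ q x + fracMax σ F₂ x ^ q x) :=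
            ENNReal.rpow_add_le_mul_rpow_add_rpow _ _ (hq.isExponent.one_lt_apply x).le
        _ ≤ _ := by
            refine mul_le_mul_left (ENNReal.rpow_le_rpow_of_exponent_le one_le_two ?_) _
            linarith [hq.isExponent.le_essSup x]
    · simpa using ENNReal.rpow_le_rpow_of_exponent_ge (ENNReal.inv_le_one.2 hC1)
        (hq.isExponent.one_lt_apply x).le
  have h2Q : (2 : ℝ≥0∞) ^ (Q - 1) ≠ ∞ :=
    ENNReal.rpow_ne_top_of_nonneg (by linarith) ENNReal.ofNat_ne_top
  refine (lintegral_mono hpt).trans ?_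
  rw [lintegral_mul_const' _ _ (ENNReal.inv_ne_top.2 hC0), lintegral_const_mul' _ _ h2Q,
    lintegral_add_left ((measurable_fracMax σ F₁).pow hq.isExponent.measurable),
    ← div_eq_mul_inv, ENNReal.div_le_iff hC0 ENNReal.coe_ne_top, one_mul, hCdef]
  push_cast
  rw [ENNReal.coe_rpow_of_nonneg _ (by linarith)]
  exact le_add_left (mul_le_mul_right (add_le_add hb₁ hb₂) _)

end FractionalMaximal

/-! ### Luxemburg norms and indicators of balls -/

section LuxemburgNorm

variable {p : ℕ} [Fact p.Prime] {n : ℕ}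

lemma varNorm_le {E : Type*} [ENorm E] {q : Qpn p n → ℝ} {f : Qpn p n → E} {η : ℝ≥0} (hη : 0 < η)
    (h : modular q f η ≤ 1) : varNorm q f ≤ η :=
  iInf₂_le η ⟨hη, h⟩

lemma varNorm_le_mul_varNorm {E E' : Type*} [ENorm E] [ENorm E'] {q q' : Qpn p n → ℝ}
    {f : Qpn p n → E} {g : Qpn p n → E'} {c : ℝ≥0∞} (hc0 : c ≠ 0) (hc : c ≠ ∞)
    (h : ∀ η : ℝ≥0, 0 < η → modular q' g η ≤ 1 →
      ∫⁻ x, (‖f x‖ₑ / (c * η)) ^ q x ∂(haar p n) ≤ 1) :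
    varNorm q f ≤ c * varNorm q' g := by
  unfold varNorm
  rw [ENNReal.mul_iInf_of_ne hc0 hc]
  refine le_iInf fun η => ?_
  rw [ENNReal.mul_iInf_of_ne hc0 hc]
  refine le_iInf fun hη => ?_
  have hcη : ((c.toNNReal * η : ℝ≥0) : ℝ≥0∞) = c * η := by
    rw [ENNReal.coe_mul, ENNReal.coe_toNNReal hc]
  rw [← hcη]
  refine varNorm_le (mul_pos (ENNReal.toNNReal_pos hc0 hc) hη.1) ?_
  rw [modular, hcη]
  exact h η hη.1 hη.2

lemma varNorm_le_mul_of_ae_le {E E' : Type*} [ENorm E] [ENorm E'] {q : Qpn p n → ℝ}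
    (hq : IsExponent q) {f : Qpn p n → E} {g : Qpn p n → E'} {c : ℝ≥0∞} (hc0 : c ≠ 0)
    (hc : c ≠ ∞) (h : ∀ᵐ x ∂(haar p n), ‖f x‖ₑ ≤ c * ‖g x‖ₑ) :
    varNorm q f ≤ c * varNorm q g := by
  refine varNorm_le_mul_varNorm hc0 hc fun η hη hg => le_trans (lintegral_mono_ae ?_) hg
  filter_upwards [h] with x hx
  refine ENNReal.rpow_le_rpow ?_ (hq.pos x).le
  refine (ENNReal.div_le_div_right hx _).trans_eq ?_
  exact ENNReal.mul_div_mul_left _ _ hc0 hc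

lemma div_rpow_le_rpow_div {a c : ℝ≥0∞} {s : ℝ} (hc : 1 ≤ c) (hs : 1 ≤ s) :
    (a / c) ^ s ≤ a ^ s / c := by
  rw [div_eq_mul_inv, ENNReal.mul_rpow_of_nonneg _ _ (zero_le_one.trans hs), div_eq_mul_inv]
  refine mul_le_mul_right ?_ _
  simpa using ENNReal.rpow_le_rpow_of_exponent_ge (ENNReal.inv_le_one.2 hc) hs

lemma lintegral_div_rpow_le_one {q : Qpn p n → ℝ} (hq : IsExponent q) {F : Qpn p n → ℝ≥0∞}
    {C : ℝ≥0} (hC : 1 ≤ C) (h : ∫⁻ x, F x ^ q x ∂(haar p n) ≤ C) :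
    ∫⁻ x, (F x / C) ^ q x ∂(haar p n) ≤ 1 := by
  have hC' : (1 : ℝ≥0∞) ≤ C := by exact_mod_cast hC
  have hC0 : (C : ℝ≥0∞) ≠ 0 := (zero_lt_one.trans_le hC').ne'
  calc _ ≤ ∫⁻ x, F x ^ q x * (C : ℝ≥0∞)⁻¹ ∂(haar p n) :=
        lintegral_mono fun x => div_rpow_le_rpow_div hC' (hq.one_lt_apply x).le
    _ ≤ 1 := by
        rw [lintegral_mul_const' _ _ (ENNReal.inv_ne_top.2 hC0), ← div_eq_mul_inv,
          ENNReal.div_le_iff hC0 ENNReal.coe_ne_top, one_mul]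
        exact h

lemma MemVarLp.exists_modular_le_one {E : Type*} [ENorm E] [MeasurableSpace E] {q : Qpn p n → ℝ}
    (hq : IsExponent q) {f : Qpn p n → E} (hf : MemVarLp q f) :
    ∃ η : ℝ≥0, 0 < η ∧ modular q f η ≤ 1 := by
  obtain ⟨-, η, hη, h⟩ := hf
  obtain ⟨M, hM⟩ := ENNReal.lt_iff_exists_coe.1 h
  refine ⟨η * (M + 1), by positivity, ?_⟩
  have h1 := lintegral_div_rpow_le_one hq (F := fun x => ‖f x‖ₑ / (η : ℝ≥0∞)) (C := M + 1)
    le_add_self (hM.1.trans_le (by exact_mod_cast le_self_add))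
  refine le_trans (le_of_eq (lintegral_congr fun x => ?_)) h1
  congr 1
  have hM1 : (((M + 1 : ℝ≥0)) : ℝ≥0∞) ≠ 0 := by simp
  have hη0 : (η : ℝ≥0∞) ≠ 0 := by simpa using hη.ne'
  rw [ENNReal.coe_mul, div_eq_mul_inv, div_eq_mul_inv, div_eq_mul_inv,
    ENNReal.mul_inv (Or.inl hη0) (Or.inl ENNReal.coe_ne_top), mul_assoc]

lemma modular_indicator_one {q : Qpn p n → ℝ} (hq : IsExponent q) (γ : ℤ) (a : Qpn p n)
    (η : ℝ≥0) : modular q ((pball γ a).indicator fun _ => (1 : ℝ)) η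
      = ∫⁻ x in pball γ a, ((η : ℝ≥0∞)⁻¹) ^ q x ∂(haar p n) := by
  rw [modular, ← lintegral_indicator (measurableSet_pball γ a)]
  refine lintegral_congr fun x => ?_
  by_cases h : x ∈ pball γ a
  · simp [h]
  · simp [h, ENNReal.zero_rpow_of_pos (hq.pos x)]

lemma memVarLp_indicator_one {q : Qpn p n → ℝ} (hq : IsExponent q) (γ : ℤ) (a : Qpn p n) :
    MemVarLp q ((pball γ a).indicator fun _ => (1 : ℝ)) := by
  refine ⟨(measurable_const.indicator (measurableSet_pball γ a)).aemeasurable, 1, zero_lt_one, ?_⟩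
  rw [modular_indicator_one hq]
  simpa using (haar_pball_ne_top γ a).lt_top

lemma varNorm_indicator_one_ne_top {q : Qpn p n → ℝ} (hq : IsExponent q) (γ : ℤ)
    (a : Qpn p n) : varNorm q ((pball γ a).indicator fun _ => (1 : ℝ)) ≠ ∞ := by
  obtain ⟨η, hη, h⟩ := (memVarLp_indicator_one hq γ a).exists_modular_le_one hq
  exact ((varNorm_le hη h).trans_lt ENNReal.coe_lt_top).ne

lemma varNorm_indicator_one_ne_zero {q : Qpn p n → ℝ} (hq : IsExponent q) (γ : ℤ)
    (a : Qpn p n) : varNorm q ((pball γ a).indicator fun _ => (1 : ℝ)) ≠ 0 := by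
  have hV := haar_pball_ne_zero γ a
  suffices h : min 1 (haar p n (pball γ a)) ≤
      varNorm q ((pball γ a).indicator fun _ => (1 : ℝ)) from
    ((lt_min zero_lt_one (pos_iff_ne_zero.2 hV)).trans_le h).ne'
  refine le_iInf₂ fun η hη => ?_
  obtain ⟨hη0, hη⟩ := hη
  rcases le_total 1 (η : ℝ≥0∞) with h | h
  · exact (min_le_left _ _).trans h
  · refine (min_le_right _ _).trans ?_
    rw [modular_indicator_one hq] at hη
    have h0 : (η : ℝ≥0∞) ≠ 0 := by simpa using hη0.ne'
    have h1 : (η : ℝ≥0∞)⁻¹ * haar p n (pball γ a) ≤ 1 := by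
      rw [← setLIntegral_const]
      refine le_trans (lintegral_mono fun x => ?_) hη
      simpa using ENNReal.rpow_le_rpow_of_exponent_le (ENNReal.one_le_inv.2 h)
        (hq.one_lt_apply x).le
    rwa [← ENNReal.div_eq_inv_mul, ENNReal.div_le_iff h0 ENNReal.coe_ne_top, one_mul] at h1

/-- The exponents satisfy `σ r + r / q = 1`, so the powers of `V` combine to exactly `V⁻¹`. -/
lemma inv_rpow_mul_rpow_le {V A K : ℝ≥0∞} (hV0 : V ≠ 0) (hV : V ≠ ∞) (hK : 1 ≤ K) {r q σ : ℝ}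
    (hr : 0 < r) (hq : 0 < q) (hσ : 0 ≤ σ) (hrel : 1 / q = 1 / r - σ) (hA : A ^ q ≤ K / V) :
    ((V ^ σ)⁻¹ * A) ^ r ≤ K * V⁻¹ := by
  have h1 : σ * r + r / q = 1 := by field_simp at hrel ⊢; linarith
  have h0 : 0 ≤ r / q := by positivity
  have h2 : r / q ≤ 1 := by nlinarith [mul_nonneg hσ hr.le]
  have h3 : A ^ r = (A ^ q) ^ (r / q) := by
    rw [← ENNReal.rpow_mul, mul_div_cancel₀ _ hq.ne']
  rw [ENNReal.mul_rpow_of_nonneg _ _ hr.le, h3]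
  calc ((V ^ σ)⁻¹) ^ r * (A ^ q) ^ (r / q) ≤ ((V ^ σ)⁻¹) ^ r * (K / V) ^ (r / q) := by gcongr
    _ = K ^ (r / q) * V⁻¹ := by
        rw [div_eq_mul_inv K, ENNReal.mul_rpow_of_nonneg _ _ h0, ← ENNReal.inv_rpow,
          ← ENNReal.rpow_mul, mul_left_comm, ← ENNReal.rpow_add _ _ (ENNReal.inv_ne_zero.2 hV)
          (ENNReal.inv_ne_top.2 hV0), h1, ENNReal.rpow_one]
    _ ≤ K * V⁻¹ := by
        refine mul_le_mul_left ?_ _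
        simpa using ENNReal.rpow_le_rpow_of_exponent_le hK h2

/-- The modular form of the comparison of `‖χ_B‖_{r(·)}` with `‖χ_B‖_{q(·)}`, where `t` stands for
the inverse of the norm parameter. -/
lemma exists_setLIntegral_rpow_le (hn : n ≠ 0) {r q : Qpn p n → ℝ} (hr : IsLogHolder r)
    (hq : IsLogHolder q) {σ : ℝ} (hσ : 0 ≤ σ) (hrel : ∀ x, 1 / q x = 1 / r x - σ) :
    ∃ C : ℝ≥0, 1 ≤ C ∧ ∀ (γ : ℤ) (a : Qpn p n) (t : ℝ≥0∞),
      ∫⁻ x in pball γ a, t ^ q x ∂(haar p n) ≤ 1 →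
      ∫⁻ x in pball γ a, ((haar p n (pball γ a) ^ σ)⁻¹ * t) ^ r x ∂(haar p n) ≤ C := by
  obtain ⟨K, hK, hloc⟩ := hq.exists_local_bound
  obtain ⟨r₀, q₀, K₂, hr₀, hq₀, hrel₀, hK₂, hcmp⟩ := exists_limit_exponents hn hr hq hrel
  have hr₀' : 0 < r₀ := zero_lt_one.trans hr₀
  have hq₀' : 0 < q₀ := zero_lt_one.trans hq₀
  obtain ⟨H, hH, -⟩ := ENNReal.lt_iff_exists_coe.1 (lintegral_decayFun_lt_top (p := p) (n := n))
  refine ⟨K + (K₂ * (K₂ + H) + H), hK.trans le_self_add, fun γ a t ht => ?_⟩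
  set V := haar p n (pball γ a) with hV
  have hV0 : V ≠ 0 := haar_pball_ne_zero γ a
  have hVt : V ≠ ∞ := haar_pball_ne_top γ a
  have hK' : (1 : ℝ≥0∞) ≤ K := by exact_mod_cast hK
  have hHle : ∫⁻ x in pball γ a, decayFun p n x ∂(haar p n) ≤ H :=
    (setLIntegral_le_lintegral _ _).trans_eq hH
  -- For `t ≥ 1` the local estimate is applied to `t χ_B`; for `t ≤ 1` and `V ≤ 1` the bound `t ^ q
  -- x ≤ K / V` is trivial. In the remaining case `t` and `V ^ (-σ) * t` are at most 1, and the
  -- limit exponents are used.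
  by_cases hcase : 1 ≤ t ∨ V ≤ 1
  · have hpt : ∀ᵐ x ∂(haar p n).restrict (pball γ a), t ^ q x ≤ K / V := by
      rcases le_total 1 t with h1 | h1
      · rw [ae_restrict_iff' (measurableSet_pball γ a)]
        filter_upwards [hloc] with x hx hxa
        obtain ⟨ρ, h3, h4, h5, h6⟩ := hx γ
        have hF := ballAvg_rpow_le_of_local_bound (γ := γ) (x := x) hq.isExponent hK
          (F := (pball γ a).indicator fun _ => t)
          (measurable_const.indicator (measurableSet_pball γ a))
          (fun y => by by_cases h : y ∈ pball γ a <;> simp [h, h1]) (by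
            refine le_trans (le_of_eq ?_) ht
            rw [← lintegral_indicator (measurableSet_pball γ a)]
            refine lintegral_congr fun y => ?_
            by_cases h : y ∈ pball γ a
            · simp [h]
            · simp [h, ENNReal.zero_rpow_of_pos (hq.isExponent.pos y)]) h3 h4 h5 h6
        have hA : ballAvg γ ((pball γ a).indicator fun _ => t) x = t := by
          refine Eq.trans ?_ (ballAvg_const t γ x)
          unfold ballAvg
          rw [pball_eq_of_mem hxa]
          congr 1
          exact setLIntegral_congr_fun (measurableSet_pball γ a) fun y hy =>
            Set.indicator_of_mem hy _
        rw [hA, pball_eq_of_mem hxa] at hF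
        exact hF.2
      · have hV1 : V ≤ 1 := by
          rcases hcase with h | h
          · have : t = 1 := le_antisymm h1 h
            simpa [this] using ht
          · exact h
        refine ae_of_all _ fun x => ?_
        calc t ^ q x ≤ 1 := ENNReal.rpow_le_one h1 (hq.isExponent.pos x).le
          _ ≤ K * V⁻¹ := one_le_mul hK' (ENNReal.one_le_inv.2 hV1)
    calc _ ≤ ∫⁻ _ in pball γ a, K * V⁻¹ ∂(haar p n) := by
          refine lintegral_mono_ae ?_
          filter_upwards [hpt] with x hx
          exact inv_rpow_mul_rpow_le hV0 hVt hK' (hr.isExponent.pos x) (hq.isExponent.pos x) hσ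
            (hrel x) hx
      _ = K := by
          rw [setLIntegral_const, mul_assoc, ENNReal.inv_mul_cancel hV0 hVt, mul_one]
      _ ≤ _ := by exact_mod_cast le_self_add
  · push Not at hcase
    obtain ⟨ht1, hV1⟩ := hcase
    have hK₁ : (1 : ℝ≥0∞) ≤ K₂ + H := by exact_mod_cast hK₂.trans le_self_add
    have h1 : t ^ q₀ ≤ (K₂ + H) / V := by
      rw [ENNReal.le_div_iff_mul_le (Or.inl hV0) (Or.inl hVt), ← setLIntegral_const]
      calc _ ≤ ∫⁻ x in pball γ a, (K₂ * t ^ q x + decayFun p n x) ∂(haar p n) :=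
            lintegral_mono fun x => (hcmp x t ht1.le).2.2.2
        _ ≤ K₂ * 1 + H := by
            rw [lintegral_add_right _ measurable_decayFun,
              lintegral_const_mul' _ _ ENNReal.coe_ne_top]
            gcongr
        _ = _ := by rw [mul_one]
    have h2 := inv_rpow_mul_rpow_le hV0 hVt hK₁ hr₀' hq₀' hσ hrel₀ h1
    have hu : (V ^ σ)⁻¹ * t ≤ 1 := by
      refine mul_le_one' (ENNReal.inv_le_one.2 ?_) ht1.le
      simpa using ENNReal.rpow_le_rpow_of_exponent_le hV1.le hσ
    calc _ ≤ ∫⁻ x in pball γ a, (K₂ * ((V ^ σ)⁻¹ * t) ^ r₀ + decayFun p n x) ∂(haar p n) :=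
          lintegral_mono fun x => (hcmp x _ hu).1
      _ ≤ K₂ * ((K₂ + H) * V⁻¹) * V + H := by
          rw [lintegral_add_right _ measurable_decayFun, setLIntegral_const]
          gcongr
      _ = K₂ * (K₂ + H) + H := by
          rw [mul_assoc, mul_assoc, ENNReal.inv_mul_cancel hV0 hVt, mul_one]
      _ ≤ _ := by exact_mod_cast le_add_self

/-- The norms of indicators of balls satisfy `‖χ_B‖_{r(·)} ≤ C |B|^σ ‖χ_B‖_{q(·)}`. -/
theorem exists_varNorm_indicator_one_le (hn : n ≠ 0) {r q : Qpn p n → ℝ} (hr : IsLogHolder r)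
    (hq : IsLogHolder q) {σ : ℝ} (hσ : 0 ≤ σ) (hrel : ∀ x, 1 / q x = 1 / r x - σ) :
    ∃ C : ℝ≥0, ∀ (γ : ℤ) (a : Qpn p n),
      varNorm r ((pball γ a).indicator fun _ => (1 : ℝ)) ≤
        C * haar p n (pball γ a) ^ σ * varNorm q ((pball γ a).indicator fun _ => (1 : ℝ)) := by
  obtain ⟨C, hC, h⟩ := exists_setLIntegral_rpow_le hn hr hq hσ hrel
  have hC0 : (C : ℝ≥0∞) ≠ 0 := by simpa using (zero_lt_one.trans_le hC).ne'
  refine ⟨C, fun γ a => ?_⟩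
  set V := haar p n (pball γ a) ^ σ with hV
  have hV0 : V ≠ 0 := (ENNReal.rpow_pos (pos_iff_ne_zero.2 (haar_pball_ne_zero γ a))
    (haar_pball_ne_top γ a)).ne'
  have hVt : V ≠ ∞ := ENNReal.rpow_ne_top_of_nonneg hσ (haar_pball_ne_top γ a)
  refine varNorm_le_mul_varNorm (mul_ne_zero hC0 hV0) (ENNReal.mul_ne_top ENNReal.coe_ne_top hVt)
    fun η hη hm => ?_
  have hη0 : (η : ℝ≥0∞) ≠ 0 := by simpa using hη.ne'
  rw [modular_indicator_one hq.isExponent] at hm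
  have h1 := h γ a _ hm
  rw [← lintegral_indicator (measurableSet_pball γ a)] at h1
  refine le_trans (lintegral_mono fun x => ?_) (lintegral_div_rpow_le_one hr.isExponent
    (F := (pball γ a).indicator fun _ => V⁻¹ * (η : ℝ≥0∞)⁻¹) hC
    (le_trans (lintegral_mono fun x => ?_) h1))
  · refine ENNReal.rpow_le_rpow ?_ (hr.isExponent.pos x).le
    by_cases hx : x ∈ pball γ a
    · simp only [hx, Set.indicator_of_mem, enorm_one]
      rw [div_eq_mul_inv, div_eq_mul_inv, one_mul, mul_assoc,
        ENNReal.mul_inv (Or.inl hC0) (Or.inl ENNReal.coe_ne_top),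
        ENNReal.mul_inv (Or.inl hV0) (Or.inl hVt), mul_comm]
    · simp [hx]
  · by_cases hx : x ∈ pball γ a
    · simp [hx, ← hV]
    · simp [hx, ENNReal.zero_rpow_of_pos (hr.isExponent.pos x)]

end LuxemburgNorm

/-! ### The commutator and mean oscillation -/

section Commutator

variable {p : ℕ} [Fact p.Prime] {n : ℕ}

lemma enorm_sub_le_lipNorm_mul {β : ℝ} (hβ : 0 < β) (b : Qpn p n → ℝ) (x y : Qpn p n) :
    ‖b x - b y‖ₑ ≤ lipNorm β b * ‖x - y‖ₑ ^ β := by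
  rcases eq_or_ne x y with rfl | h
  · simp
  have h0 : ‖x - y‖ₑ ≠ 0 := by simpa [sub_eq_zero] using h
  rw [← ENNReal.div_le_iff (ENNReal.rpow_pos (pos_iff_ne_zero.2 h0) enorm_ne_top).ne'
    (ENNReal.rpow_ne_top_of_nonneg hβ.le enorm_ne_top)]
  exact le_iSup₂_of_le x y (le_iSup_of_le h le_rfl)

lemma enorm_sub_le_of_mem_pball_of_lip (hn : n ≠ 0) {β : ℝ} (hβ : 0 < β) (b : Qpn p n → ℝ)
    {γ : ℤ} {x y : Qpn p n} (hy : y ∈ pball γ x) :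
    ‖b x - b y‖ₑ ≤ lipNorm β b * haar p n (pball γ x) ^ (β / n) := by
  refine (enorm_sub_le_lipNorm_mul hβ b x y).trans ?_
  rw [haar_pball_rpow_div hn, ENNReal.rpow_mul]
  gcongr
  exact enorm_sub_le_of_mem_pball hy

lemma rpow_haar_pball_ne_zero (s : ℝ) (γ : ℤ) (x : Qpn p n) :
    haar p n (pball γ x) ^ s ≠ 0 :=
  (ENNReal.rpow_pos (pos_iff_ne_zero.2 (haar_pball_ne_zero γ x)) (haar_pball_ne_top γ x)).ne'

lemma rpow_haar_pball_ne_top {s : ℝ} (hs : 0 ≤ s) (γ : ℤ) (x : Qpn p n) :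
    haar p n (pball γ x) ^ s ≠ ∞ :=
  ENNReal.rpow_ne_top_of_nonneg hs (haar_pball_ne_top γ x)

lemma maxCommutator_le_mul_fracMax (hn : n ≠ 0) {α β : ℝ} (hβ : 0 < β) {b b' : Qpn p n → ℝ}
    (hb' : lipNorm β b' ≠ ∞) (hbb : b =ᵐ[haar p n] b') (f : Qpn p n → ℝ) :
    ∀ᵐ x ∂(haar p n), maxCommutator α b f x ≤
      lipNorm β b' * fracMax ((α + β) / n) (fun y => ‖f y‖ₑ) x := by
  filter_upwards [hbb] with x hx
  refine iSup_le fun γ => ?_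
  set V := haar p n (pball γ x) with hV
  have hV0 : V ≠ 0 := haar_pball_ne_zero γ x
  have hVt : V ≠ ∞ := haar_pball_ne_top γ x
  have h1 : ∫⁻ y in pball γ x, ‖b x - b y‖ₑ * ‖f y‖ₑ ∂(haar p n)
      ≤ lipNorm β b' * V ^ (β / n) * ∫⁻ y in pball γ x, ‖f y‖ₑ ∂(haar p n) := by
    rw [← lintegral_const_mul' _ _ (ENNReal.mul_ne_top hb'
      (ENNReal.rpow_ne_top_of_nonneg (by positivity) hVt))]
    refine lintegral_mono_ae ?_
    filter_upwards [ae_restrict_mem (measurableSet_pball γ x), ae_restrict_of_ae hbb] with y hy hby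
    rw [hx, hby]
    gcongr
    exact enorm_sub_le_of_mem_pball_of_lip hn hβ b' hy
  have h2 : (V ^ (1 - α / n))⁻¹ * V ^ (β / n) = V ^ ((α + β) / n) * V⁻¹ := by
    rw [← ENNReal.rpow_neg, ← ENNReal.rpow_neg_one, ← ENNReal.rpow_add _ _ hV0 hVt,
      ← ENNReal.rpow_add _ _ hV0 hVt]
    congr 1; ring
  calc _ ≤ (V ^ (1 - α / n))⁻¹ *
        (lipNorm β b' * V ^ (β / n) * ∫⁻ y in pball γ x, ‖f y‖ₑ ∂(haar p n)) := by gcongr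
    _ = lipNorm β b' * ((V ^ (1 - α / n))⁻¹ * V ^ (β / n) *
          ∫⁻ y in pball γ x, ‖f y‖ₑ ∂(haar p n)) := by ring
    _ = lipNorm β b' * (V ^ ((α + β) / n) * ballAvg γ (fun y => ‖f y‖ₑ) x) := by
        rw [h2, ballAvg, mul_assoc (V ^ ((α + β) / n))]
    _ ≤ _ := by
        gcongr
        exact le_iSup (fun γ => haar p n (pball γ x) ^ ((α + β) / n) *
          ballAvg γ (fun y => ‖f y‖ₑ) x) γ

lemma aemeasurable_maxCommutator {α : ℝ} {b f : Qpn p n → ℝ} (hb : AEMeasurable b (haar p n))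
    (hf : AEMeasurable f (haar p n)) : AEMeasurable (maxCommutator α b f) (haar p n) := by
  obtain ⟨b', hb', hbb⟩ := hb
  obtain ⟨f', hf', hff⟩ := hf
  refine ⟨maxCommutator α b' f', ?_, ?_⟩
  · refine Measurable.iSup fun γ => ?_
    have hE : MeasurableSet {z : Qpn p n × Qpn p n | z.2 ∈ pball γ z.1} :=
      (isClosed_le (continuous_snd.dist continuous_fst) continuous_const).measurableSet
    have hm : Measurable ({z : Qpn p n × Qpn p n | z.2 ∈ pball γ z.1}.indicator
        (fun z => ‖b' z.1 - b' z.2‖ₑ * ‖f' z.2‖ₑ)) :=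
      ((((hb'.comp measurable_fst).sub (hb'.comp measurable_snd)).enorm).mul
        (hf'.comp measurable_snd).enorm).indicator hE
    have h1 : ∀ x, ∫⁻ y in pball γ x, ‖b' x - b' y‖ₑ * ‖f' y‖ₑ ∂(haar p n)
        = ∫⁻ y, {z : Qpn p n × Qpn p n | z.2 ∈ pball γ z.1}.indicator
          (fun z => ‖b' z.1 - b' z.2‖ₑ * ‖f' z.2‖ₑ) (x, y) ∂(haar p n) := by
      intro x
      rw [← lintegral_indicator (measurableSet_pball γ x)]
      rfl
    simp_rw [h1, haar_pball]
    exact (hm.lintegral_prod_right' (ν := haar p n)).const_mul _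
  · filter_upwards [hbb] with x hx
    unfold maxCommutator
    congr! 3 with γ
    refine lintegral_congr_ae (ae_restrict_of_ae ?_)
    filter_upwards [hbb, hff] with y hy hy'
    rw [hx, hy, hy']

theorem isBoundedOp_of_ae_le_mul_fracMax (hn : n ≠ 0) {r q : Qpn p n → ℝ} (hr : IsLogHolder r)
    (hq : IsLogHolder q) {σ : ℝ} (hσ : 0 ≤ σ) (hrel : ∀ x, 1 / q x = 1 / r x - σ)
    {T : (Qpn p n → ℝ) → Qpn p n → ℝ≥0∞} {L : ℝ≥0}
    (hTm : ∀ f, AEMeasurable f (haar p n) → AEMeasurable (T f) (haar p n))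
    (hT : ∀ f, ∀ᵐ x ∂(haar p n), T f x ≤ L * fracMax σ (fun y => ‖f y‖ₑ) x) :
    IsBoundedOp r q T := by
  obtain ⟨C, hC, hmax⟩ := exists_lintegral_fracMax_div_rpow_le_one hn hr hq hσ hrel
  have hC0 : (C : ℝ≥0∞) ≠ 0 := by simpa using hC.ne'
  have hc0 : ((C * (L + 1) : ℝ≥0) : ℝ≥0∞) ≠ 0 := by
    simpa using hC.ne'
  have key : ∀ f, AEMeasurable f (haar p n) → ∀ η : ℝ≥0, 0 < η → modular r f η ≤ 1 →
      ∫⁻ x, (‖T f x‖ₑ / ((C * (L + 1) : ℝ≥0) * η)) ^ q x ∂(haar p n) ≤ 1 := by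
    intro f hf η hη hm
    have hη0 : (η : ℝ≥0∞) ≠ 0 := by simpa using hη.ne'
    refine le_trans (lintegral_mono_ae ?_)
      (hmax (fun y => ‖f y‖ₑ / η) (hf.enorm.div_const _) hm)
    filter_upwards [hT f] with x hx
    refine ENNReal.rpow_le_rpow (ENNReal.div_le_of_le_mul ?_) (hq.isExponent.pos x).le
    have h1 : fracMax σ (fun y => ‖f y‖ₑ) x = η * fracMax σ (fun y => ‖f y‖ₑ / η) x := by
      rw [← fracMax_const_mul ENNReal.coe_ne_top]
      simp_rw [ENNReal.mul_div_cancel hη0 ENNReal.coe_ne_top]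
    rw [enorm_eq_self]
    calc T f x ≤ L * (η * fracMax σ (fun y => ‖f y‖ₑ / η) x) := h1 ▸ hx
      _ ≤ (L + 1) * (η * fracMax σ (fun y => ‖f y‖ₑ / η) x) := by gcongr; exact le_self_add
      _ = (fracMax σ (fun y => ‖f y‖ₑ / η) x / C * C) * ((L + 1) * η) := by
          rw [ENNReal.div_mul_cancel hC0 ENNReal.coe_ne_top]; ring
      _ = _ := by push_cast; ring
  refine ⟨C * (L + 1), fun f hf => ⟨⟨hTm f hf.1, ?_⟩, ?_⟩⟩
  · obtain ⟨η, hη, hm⟩ := hf.exists_modular_le_one hr.isExponent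
    refine ⟨C * (L + 1) * η, by positivity, ?_⟩
    rw [modular, ENNReal.coe_mul]
    exact (key f hf.1 η hη hm).trans_lt ENNReal.one_lt_top
  · exact varNorm_le_mul_varNorm hc0 ENNReal.coe_ne_top fun η hη hm => key f hf.1 η hη hm

lemma integrableOn_pball {b : Qpn p n → ℝ} (hb : LocallyIntegrable b (haar p n)) (γ : ℤ)
    (a : Qpn p n) : IntegrableOn b (pball γ a) (haar p n) :=
  hb.integrableOn_isCompact (isCompact_pball γ a)

lemma enorm_sub_average_mul_le {b : Qpn p n → ℝ} (hb : LocallyIntegrable b (haar p n)) (γ : ℤ)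
    (a : Qpn p n) (c : ℝ) :
    ‖c - ⨍ z in pball γ a, b z ∂(haar p n)‖ₑ * haar p n (pball γ a) ≤
      ∫⁻ y in pball γ a, ‖c - b y‖ₑ ∂(haar p n) := by
  have hVt := haar_pball_ne_top γ a
  have h1 : ∫ y in pball γ a, (c - b y) ∂(haar p n)
      = (haar p n).real (pball γ a) * (c - ⨍ z in pball γ a, b z ∂(haar p n)) := by
    have hc : Integrable (fun _ => c) ((haar p n).restrict (pball γ a)) := integrableOn_const hVt
    rw [integral_sub hc (integrableOn_pball hb γ a), mul_sub,
      ← smul_eq_mul _ (⨍ z in pball γ a, b z ∂(haar p n)), measure_smul_setAverage b hVt]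
    simp
  have h2 := enorm_integral_le_lintegral_enorm (μ := (haar p n).restrict (pball γ a))
    (fun y => c - b y)
  rw [h1, enorm_mul, mul_comm] at h2
  convert h2 using 2
  rw [Measure.real, Real.enorm_eq_ofReal ENNReal.toReal_nonneg, ENNReal.ofReal_toReal hVt]

/-- The test function is `χ_B`. For `x ∈ B` the ball `B` itself competes in the supremum, and `|b(x)
- b_B|` is at most the mean of `|b(x) - b(y)|` over `y ∈ B`. -/
lemma meanOsc_lt_top_of_isBoundedOp (hn : n ≠ 0) {α β : ℝ} (hα : 0 < α) (hβ : 0 < β)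
    {b : Qpn p n → ℝ} (hb : LocallyIntegrable b (haar p n)) {r q : Qpn p n → ℝ}
    (hrq : IsAdmissible (α + β) r q) (hT : IsBoundedOp r q (maxCommutator α b)) :
    meanOsc β q b < ∞ := by
  obtain ⟨C, hC⟩ := hT
  obtain ⟨C', hC'⟩ := exists_varNorm_indicator_one_le hn hrq.logHolder_left hrq.logHolder_right
    (by positivity) hrq.rel
  refine lt_of_le_of_lt ?_ (ENNReal.coe_lt_top (r := C * C'))
  refine iSup₂_le fun γ a => ?_
  set V := haar p n (pball γ a) with hV
  have hV0 : V ≠ 0 := haar_pball_ne_zero γ a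
  have hVt : V ≠ ∞ := haar_pball_ne_top γ a
  set χ : Qpn p n → ℝ := (pball γ a).indicator fun _ => (1 : ℝ) with hχ
  have hVα0 : V ^ (α / n) ≠ 0 := rpow_haar_pball_ne_zero _ γ a
  have hVαt : V ^ (α / n) ≠ ∞ := rpow_haar_pball_ne_top (by positivity) γ a
  have hVβ0 : V ^ (β / n) ≠ 0 := rpow_haar_pball_ne_zero _ γ a
  have hVβt : V ^ (β / n) ≠ ∞ := rpow_haar_pball_ne_top (by positivity) γ a
  have hpt : ∀ x, ‖(pball γ a).indicator (fun y => b y - ⨍ z in pball γ a, b z ∂(haar p n)) x‖ₑ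
      ≤ (V ^ (α / n))⁻¹ * ‖maxCommutator α b χ x‖ₑ := by
    intro x
    by_cases hx : x ∈ pball γ a
    · rw [Set.indicator_of_mem hx, enorm_eq_self, ← ENNReal.div_eq_inv_mul,
        ENNReal.le_div_iff_mul_le (Or.inl hVα0) (Or.inl hVαt)]
      refine le_trans ?_ (le_iSup _ γ)
      rw [pball_eq_of_mem hx, ← hV]
      have h1 : ∫⁻ y in pball γ a, ‖b x - b y‖ₑ * ‖χ y‖ₑ ∂(haar p n)
          = ∫⁻ y in pball γ a, ‖b x - b y‖ₑ ∂(haar p n) :=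
        setLIntegral_congr_fun (measurableSet_pball γ a) fun y hy => by simp [hχ, hy]
      rw [h1]
      refine le_trans (le_of_eq ?_)
        (mul_le_mul_right (enorm_sub_average_mul_le hb γ a (b x)) _)
      have h2 : V ^ (α / n) = (V ^ (1 - α / n))⁻¹ * V := by
        nth_rewrite 3 [← ENNReal.rpow_one V]
        rw [← ENNReal.rpow_neg, ← ENNReal.rpow_add _ _ hV0 hVt]
        congr 1; ring
      rw [h2]; ring
    · simp [hx]
  have hχm := memVarLp_indicator_one hrq.isExponent γ a
  have hmain : varNorm q ((pball γ a).indicator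
      fun y => b y - ⨍ z in pball γ a, b z ∂(haar p n))
        ≤ C * C' * V ^ (β / n) * varNorm q χ := by
    calc _ ≤ (V ^ (α / n))⁻¹ * varNorm q (maxCommutator α b χ) :=
          varNorm_le_mul_of_ae_le hrq.logHolder_right.isExponent (ENNReal.inv_ne_zero.2 hVαt)
            (ENNReal.inv_ne_top.2 hVα0) (ae_of_all _ hpt)
      _ ≤ (V ^ (α / n))⁻¹ * (C * (C' * V ^ ((α + β) / n) * varNorm q χ)) := by
          gcongr
          exact (hC χ hχm).2.trans (by gcongr; exact hC' γ a)
      _ = (V ^ (α / n))⁻¹ * V ^ (α / n) * (C * C' * V ^ (β / n) * varNorm q χ) := by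
          rw [add_div, ENNReal.rpow_add _ _ hV0 hVt]; ring
      _ = _ := by rw [ENNReal.inv_mul_cancel hVα0 hVαt, one_mul]
  rw [← ENNReal.div_eq_inv_mul]
  refine ENNReal.div_le_of_le_mul (ENNReal.div_le_of_le_mul ?_)
  rwa [ENNReal.coe_mul]

lemma meanOsc_lt_top_of_memLip (hn : n ≠ 0) {β : ℝ} (hβ : 0 < β)
    {b b' : Qpn p n → ℝ} (hb : LocallyIntegrable b (haar p n)) (hb' : MemLip β b')
    (hbb : b =ᵐ[haar p n] b') {q : Qpn p n → ℝ} (hq : IsExponent q) :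
    meanOsc β q b < ∞ := by
  -- Adding 1 keeps the constant nonzero when `b'` is constant, as the scaling of norms requires.
  refine lt_of_le_of_lt ?_ (ENNReal.add_lt_top.2 ⟨hb'.2, ENNReal.one_lt_top⟩)
  refine iSup₂_le fun γ a => ?_
  set V := haar p n (pball γ a) with hV
  have hV0 : V ≠ 0 := haar_pball_ne_zero γ a
  have hVt : V ≠ ∞ := haar_pball_ne_top γ a
  have hVβ0 : V ^ (β / n) ≠ 0 := rpow_haar_pball_ne_zero _ γ a
  have hVβt : V ^ (β / n) ≠ ∞ := rpow_haar_pball_ne_top (by positivity) γ a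
  rw [← ENNReal.div_eq_inv_mul]
  refine ENNReal.div_le_of_le_mul (ENNReal.div_le_of_le_mul ?_)
  refine varNorm_le_mul_of_ae_le hq (by simp [hVβ0])
    (ENNReal.mul_ne_top (ENNReal.add_ne_top.2 ⟨hb'.2.ne, ENNReal.one_ne_top⟩) hVβt) ?_
  filter_upwards [hbb] with x hx
  by_cases hxa : x ∈ pball γ a
  · simp only [hxa, Set.indicator_of_mem, enorm_one, mul_one]
    have h1 : ‖b x - ⨍ z in pball γ a, b z ∂(haar p n)‖ₑ * V ≤
        (lipNorm β b' * V ^ (β / n)) * V := by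
      refine (enorm_sub_average_mul_le hb γ a (b x)).trans ?_
      rw [hV, ← setLIntegral_const]
      refine lintegral_mono_ae ?_
      filter_upwards [ae_restrict_mem (measurableSet_pball γ a), ae_restrict_of_ae hbb]
        with y hy hby
      rw [hx, hby, ← pball_eq_of_mem hxa]
      exact enorm_sub_le_of_mem_pball_of_lip hn hβ b' (pball_eq_of_mem hxa ▸ hy)
    refine ((ENNReal.mul_le_mul_iff_left hV0 hVt).1 h1).trans ?_
    gcongr
    exact le_self_add
  · simp [hxa]

end Commutator

/-! ### From mean oscillation to Lipschitz regularity -/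

section Campanato

variable {p : ℕ} [Fact p.Prime] {n : ℕ}

/-- Means over balls are controlled by `L^{q(·)}` norms. -/
lemma exists_ballAvg_mul_varNorm_le (hn : n ≠ 0) {q : Qpn p n → ℝ} (hq : IsLogHolder q) :
    ∃ C : ℝ≥0, ∀ (γ : ℤ) (a : Qpn p n) (φ : Qpn p n → ℝ), AEMeasurable φ (haar p n) →
      ballAvg γ (fun y => ‖φ y‖ₑ) a ≠ ∞ →
      ballAvg γ (fun y => ‖φ y‖ₑ) a * varNorm q ((pball γ a).indicator fun _ => (1 : ℝ)) ≤
        C * varNorm q φ := by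
  obtain ⟨C, hC, hmax⟩ := exists_lintegral_fracMax_div_rpow_le_one hn hq hq le_rfl
    (fun x => (sub_zero _).symm)
  have hC0 : (C : ℝ≥0∞) ≠ 0 := by simpa using hC.ne'
  refine ⟨C, fun γ a φ hφ hfin => ?_⟩
  set A := ballAvg γ (fun y => ‖φ y‖ₑ) a with hA
  rcases eq_or_ne A 0 with hA0 | hA0
  · simp [hA0]
  -- At every point of the ball the maximal function of `φ` is at least `A`; its boundedness on
  -- `L^{q(·)}` takes the place of Hölder's inequality and duality.
  have hmain : varNorm q ((pball γ a).indicator fun _ => (1 : ℝ)) ≤ C / A * varNorm q φ := by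
    refine varNorm_le_mul_varNorm (ENNReal.div_ne_zero.2 ⟨hC0, hfin⟩)
      (ENNReal.div_ne_top ENNReal.coe_ne_top hA0) fun η hη hm => ?_
    have hη0 : (η : ℝ≥0∞) ≠ 0 := by simpa using hη.ne'
    refine le_trans (lintegral_mono fun x => ?_)
      (hmax (fun y => ‖φ y‖ₑ / η) (hφ.enorm.div_const _) hm)
    refine ENNReal.rpow_le_rpow ?_ (hq.isExponent.pos x).le
    by_cases hx : x ∈ pball γ a
    · rw [Set.indicator_of_mem hx, enorm_one]
      have h1 : A / η ≤ fracMax 0 (fun y => ‖φ y‖ₑ / η) x := by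
        refine le_trans (le_of_eq ?_) (ballAvg_le_fracMax_zero γ _ x)
        simp_rw [ENNReal.div_eq_inv_mul]
        rw [ballAvg_const_mul (ENNReal.inv_ne_top.2 hη0), ballAvg_eq_of_mem le_rfl _ hx, hA]
      refine le_trans (le_of_eq ?_) (ENNReal.div_le_div_right h1 _)
      rw [div_eq_mul_inv, div_eq_mul_inv, div_eq_mul_inv, div_eq_mul_inv, one_mul,
        ENNReal.mul_inv (Or.inr ENNReal.coe_ne_top) (Or.inr hη0),
        ENNReal.mul_inv (Or.inl hC0) (Or.inl ENNReal.coe_ne_top), inv_inv]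
      ring
    · simp [hx]
  calc _ ≤ A * (C / A * varNorm q φ) := by gcongr
    _ = (A * (C / A)) * varNorm q φ := by rw [mul_assoc]
    _ = _ := by rw [ENNReal.mul_div_cancel hA0 hfin]

lemma exists_ballAvg_enorm_sub_average_le (hn : n ≠ 0) {β : ℝ} (hβ : 0 < β) {b : Qpn p n → ℝ}
    (hb : LocallyIntegrable b (haar p n)) {q : Qpn p n → ℝ} (hq : IsLogHolder q)
    (hosc : meanOsc β q b < ∞) :
    ∃ D : ℝ≥0, ∀ (γ : ℤ) (a : Qpn p n),
      ballAvg γ (fun y => ‖b y - ⨍ z in pball γ a, b z ∂(haar p n)‖ₑ) a ≤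
        D * (p : ℝ≥0∞) ^ (γ * β) := by
  obtain ⟨C, hC⟩ := exists_ballAvg_mul_varNorm_le hn hq
  obtain ⟨M, hM, -⟩ := ENNReal.lt_iff_exists_coe.1 hosc
  refine ⟨C * M, fun γ a => ?_⟩
  rw [← haar_pball_rpow_div hn γ a]
  set V := haar p n (pball γ a) with hV
  have hV0 : V ≠ 0 := haar_pball_ne_zero γ a
  have hVβ0 : V ^ (β / n) ≠ 0 := rpow_haar_pball_ne_zero _ γ a
  have hVβt : V ^ (β / n) ≠ ∞ := rpow_haar_pball_ne_top (by positivity) γ a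
  set φ := (pball γ a).indicator (fun y => b y - ⨍ z in pball γ a, b z ∂(haar p n)) with hφ
  set X := varNorm q ((pball γ a).indicator fun _ => (1 : ℝ)) with hX
  have hX0 : X ≠ 0 := varNorm_indicator_one_ne_zero hq.isExponent γ a
  have hXt : X ≠ ∞ := varNorm_indicator_one_ne_top hq.isExponent γ a
  have hint : IntegrableOn (fun y => b y - ⨍ z in pball γ a, b z ∂(haar p n)) (pball γ a)
      (haar p n) := by
    refine (integrableOn_pball hb γ a).sub ?_
    exact integrableOn_const (haar_pball_ne_top γ a)
  have hA : ballAvg γ (fun y => ‖b y - ⨍ z in pball γ a, b z ∂(haar p n)‖ₑ) a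
      = ballAvg γ (fun y => ‖φ y‖ₑ) a := by
    unfold ballAvg
    congr 1
    exact setLIntegral_congr_fun (measurableSet_pball γ a) fun y hy => by simp [hφ, hy]
  have hAt : ballAvg γ (fun y => ‖φ y‖ₑ) a ≠ ∞ := by
    rw [← hA]
    exact ENNReal.mul_ne_top (ENNReal.inv_ne_top.2 hV0) hint.2.ne
  have hφm : AEMeasurable φ (haar p n) :=
    (hb.aestronglyMeasurable.aemeasurable.sub_const _).indicator (measurableSet_pball γ a)
  have hN : varNorm q φ ≤ M * V ^ (β / n) * X := by
    have h1 : (V ^ (β / n))⁻¹ * (varNorm q φ / X) ≤ M := by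
      rw [← hM]
      exact le_iSup₂ (f := fun (γ : ℤ) (x : Qpn p n) => (haar p n (pball γ x) ^ (β / n))⁻¹ *
        (varNorm q ((pball γ x).indicator fun y => b y - ⨍ z in pball γ x, b z ∂(haar p n)) /
          varNorm q ((pball γ x).indicator fun _ => (1 : ℝ)))) γ a
    rw [← ENNReal.div_eq_inv_mul, ENNReal.div_le_iff hVβ0 hVβt, ENNReal.div_le_iff hX0 hXt] at h1
    exact h1
  rw [hA]
  have h2 := (hC γ a φ hφm hAt).trans (mul_le_mul_right hN _)
  rw [← mul_assoc, ← mul_assoc, ENNReal.mul_le_mul_iff_left hX0 hXt] at h2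
  rwa [ENNReal.coe_mul]

/-- The Campanato characterization of Lipschitz functions: a locally integrable function whose mean
oscillation on balls of radius `p ^ γ` is `O(p ^ (γ β))` agrees almost everywhere with a function
in `Λ_β`. -/
theorem exists_memLip_of_ballAvg_le {β : ℝ} (hβ : 0 < β) {b : Qpn p n → ℝ}
    (hb : LocallyIntegrable b (haar p n)) {D : ℝ≥0}
    (hD : ∀ (γ : ℤ) (a : Qpn p n),
      ballAvg γ (fun y => ‖b y - ⨍ z in pball γ a, b z ∂(haar p n)‖ₑ) a ≤
        D * (p : ℝ≥0∞) ^ (γ * β)) :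
    ∃ b' : Qpn p n → ℝ, MemLip β b' ∧ b =ᵐ[haar p n] b' := by
  have hp0 := prime_pos (p := p)
  have hp1 := one_lt_prime (p := p)
  set m : ℤ → Qpn p n → ℝ := fun γ x => ⨍ z in pball γ x, b z ∂(haar p n) with hm
  have hmconst : ∀ γ x, ∀ y ∈ pball γ x, m γ y = m γ x := by
    intro γ x y hy
    rw [hm]; dsimp only; rw [pball_eq_of_mem hy]
  -- The factor `p ^ n` is the ratio of the measures of consecutive balls.
  set E : ℝ := (p : ℝ) ^ n * D with hE
  have hE0 : 0 ≤ E := by positivity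
  have hstep : ∀ γ x, dist (m γ x) (m (γ - 1) x) ≤ E * (p : ℝ) ^ (γ * β) := by
    intro γ x
    set V := haar p n (pball (γ - 1) x) with hV
    have hV0 : V ≠ 0 := haar_pball_ne_zero _ x
    have hVt : V ≠ ∞ := haar_pball_ne_top _ x
    have hB0 := haar_pball_ne_zero γ x
    have hBt := haar_pball_ne_top γ x
    have h1 : ‖m γ x - m (γ - 1) x‖ₑ * V ≤ ((p : ℝ≥0∞) ^ n * (D * (p : ℝ≥0∞) ^ (γ * β))) * V := by
      refine (enorm_sub_average_mul_le hb (γ - 1) x (m γ x)).trans ?_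
      calc _ ≤ ∫⁻ y in pball γ x, ‖m γ x - b y‖ₑ ∂(haar p n) :=
            lintegral_mono_set (pball_mono (by omega) x)
        _ = haar p n (pball γ x) * ballAvg γ (fun y => ‖b y - m γ x‖ₑ) x := by
            rw [ballAvg, ← mul_assoc, ENNReal.mul_inv_cancel hB0 hBt, one_mul]
            simp_rw [enorm_sub_rev]
        _ ≤ haar p n (pball γ x) * (D * (p : ℝ≥0∞) ^ (γ * β)) := by
            gcongr
            exact hD γ x
        _ = _ := by rw [haar_pball_succ]; ring
    have h2 := (ENNReal.mul_le_mul_iff_left hV0 hVt).1 h1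
    rw [Real.dist_eq, ← Real.norm_eq_abs]
    have h3 : (p : ℝ≥0∞) ^ n * (D * (p : ℝ≥0∞) ^ (γ * β))
        = ENNReal.ofReal (E * (p : ℝ) ^ (γ * β)) := by
      rw [hE, ENNReal.ofReal_mul (by positivity), ENNReal.ofReal_mul (by positivity),
        ENNReal.ofReal_pow hp0.le, ENNReal.ofReal_natCast, ENNReal.ofReal_coe_nnreal,
        ← ENNReal.ofReal_rpow_of_pos hp0, ENNReal.ofReal_natCast, mul_assoc]
    rw [h3, ← ofReal_norm] at h2
    exact (ENNReal.ofReal_le_ofReal_iff (by positivity)).1 h2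
  set ρ : ℝ := (p : ℝ) ^ (-β) with hρ
  have hρ1 : ρ < 1 := Real.rpow_lt_one_of_one_lt_of_neg hp1 (by linarith)
  have hgeo : ∀ γ x (k : ℕ), dist (m (γ - k) x) (m (γ - (k + 1 : ℕ)) x)
      ≤ E * (p : ℝ) ^ (γ * β) * ρ ^ k := by
    intro γ x k
    have h1 := hstep (γ - k) x
    have h2 : γ - (k + 1 : ℕ) = γ - k - 1 := by push_cast; ring
    rw [h2]
    refine h1.trans (le_of_eq ?_)
    rw [hρ, ← Real.rpow_natCast, ← Real.rpow_mul hp0.le, mul_assoc E, ← Real.rpow_add hp0]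
    congr 2; push_cast; ring
  have hlim0 : ∀ x, ∃ l, Tendsto (fun k : ℕ => m (0 - k) x) atTop (𝓝 l) := fun x =>
    cauchySeq_tendsto_of_complete (cauchySeq_of_le_geometric ρ _ hρ1 (hgeo 0 x))
  choose b' hb' using hlim0
  have hlim : ∀ γ x, Tendsto (fun k : ℕ => m (γ - k) x) atTop (𝓝 (b' x)) := by
    intro γ x
    rw [← tendsto_add_atTop_iff_nat γ.toNat]
    have h1 := (tendsto_add_atTop_iff_nat (-γ).toNat).2 (hb' x)
    refine h1.congr fun k => ?_
    congr 1
    push_cast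
    omega
  set E' : ℝ := E / (1 - ρ) with hE'
  have hE'0 : 0 ≤ E' := div_nonneg hE0 (by linarith)
  have hdist : ∀ γ x, dist (m γ x) (b' x) ≤ E' * (p : ℝ) ^ (γ * β) := by
    intro γ x
    have := dist_le_of_le_geometric_of_tendsto₀ ρ _ hρ1 (hgeo γ x) (hlim γ x)
    simp only [Nat.cast_zero, sub_zero] at this
    refine this.trans (le_of_eq ?_)
    rw [hE']; ring
  have hlip : ∀ x y, x ≠ y → ‖b' x - b' y‖ ≤ 2 * E' * ‖x - y‖ ^ β := by
    intro x y hxy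
    -- At the scale `p ^ γ = |x - y|` both points lie in one ball and share its mean, so no chaining
    -- between neighbouring balls is needed.
    obtain ⟨γ, hγ⟩ := exists_norm_eq_zpow (sub_ne_zero.2 hxy)
    have h1 : m γ x = m γ y := hmconst γ y x (mem_pball.2 hγ.le)
    have h2 : ‖x - y‖ ^ β = (p : ℝ) ^ (γ * β) := by
      rw [hγ, ← Real.rpow_intCast, ← Real.rpow_mul hp0.le]
    rw [h2, ← dist_eq_norm]
    have h3 := dist_triangle_left (b' x) (b' y) (m γ x)
    have h4 := hdist γ x
    have h5 := hdist γ y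
    rw [← h1] at h5
    linarith
  refine ⟨b', ⟨?_, ?_⟩, ?_⟩
  · exact measurable_of_tendsto_metrizable (f := fun (k : ℕ) x => m (0 - k) x)
      (fun k => measurable_of_const_on_pball (hmconst _)) (tendsto_pi_nhds.2 hb')
  · refine lt_of_le_of_lt ?_ (ENNReal.ofReal_lt_top (r := 2 * E'))
    refine iSup₂_le fun x y => iSup_le fun hxy => ENNReal.div_le_of_le_mul ?_
    have hpos : 0 < ‖x - y‖ := norm_pos_iff.2 (sub_ne_zero.2 hxy)
    rw [← ofReal_norm, ← ofReal_norm, ENNReal.ofReal_rpow_of_pos hpos,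
      ← ENNReal.ofReal_mul (by positivity)]
    exact ENNReal.ofReal_le_ofReal (hlip x y hxy)
  -- Lebesgue differentiation: almost everywhere the means converge to `b` as well as to `b'`.
  · filter_upwards [IsUnifLocDoublingMeasure.ae_tendsto_average (haar p n) hb 1] with x hx
    have hδ : Tendsto (fun k : ℕ => (p : ℝ) ^ (0 - k : ℤ)) atTop (𝓝[>] 0) := by
      refine tendsto_nhdsWithin_iff.2 ⟨?_, Eventually.of_forall fun k => zpow_pos hp0 _⟩
      have h1 := tendsto_pow_atTop_nhds_zero_of_lt_one (r := (p : ℝ)⁻¹) (by positivity)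
        (inv_lt_one_of_one_lt₀ hp1)
      refine h1.congr fun k => ?_
      rw [zero_sub, zpow_neg, zpow_natCast, inv_pow]
    exact tendsto_nhds_unique (hx (fun _ : ℕ => x) _ hδ
      (Eventually.of_forall fun k => Metric.mem_closedBall_self (by positivity))) (hb' x)

end Campanato

/-! ### Existence of admissible pairs -/

section ConstantExponents

variable {p : ℕ} [Fact p.Prime] {n : ℕ}

lemma isLogHolder_const {c : ℝ} (hc : 1 < c) : IsLogHolder (fun _ : Qpn p n => c) := by
  have h0 : haar p n ≠ 0 := fun h => haar_pball_ne_zero 0 (0 : Qpn p n) (by simp [h])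
  refine ⟨⟨measurable_const, ?_, fun x => ?_, fun x => ?_⟩, ⟨1, one_pos, fun γ x => ?_⟩,
    ⟨1, one_pos, fun x y => ?_⟩⟩
  · rwa [essInf_const _ h0]
  · rw [essInf_const _ h0]
  · rw [essSup_const _ h0]
  · have h1 : (haar p n).restrict (pball γ x) ≠ 0 := fun h =>
      haar_pball_ne_zero γ x (Measure.restrict_eq_zero.1 h)
    rw [essInf_const _ h1, essSup_const _ h1]
    simp
  · rw [sub_self, abs_zero]
    refine div_nonneg zero_le_one (Real.logb_nonneg one_lt_prime ?_)
    have := one_lt_prime (p := p)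
    have : 0 ≤ min ‖x‖ ‖y‖ := by positivity
    linarith

/-- Constant exponents suffice. This keeps the assertions about all admissible pairs from being
vacuous, so that each implies its counterpart for some pair. -/
lemma exists_isAdmissible {s : ℝ} (hs : 0 < s) (hsn : s < n) :
    ∃ r q : Qpn p n → ℝ, IsAdmissible s r q := by
  have hn : (0 : ℝ) < n := hs.trans hsn
  obtain ⟨c, hc1, hc2⟩ := exists_between ((one_lt_div hs).2 hsn)
  have hc0 : 0 < c := zero_lt_one.trans hc1
  have h0 : haar p n ≠ 0 := fun h => haar_pball_ne_zero 0 (0 : Qpn p n) (by simp [h])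
  have hd : 0 < 1 / c - s / n := by
    rw [sub_pos, lt_div_iff₀ hc0]
    rw [lt_div_iff₀ hs] at hc2
    rw [div_mul_eq_mul_div, div_lt_one hn]
    linarith
  have hd1 : 1 / c - s / n < 1 := by
    have h1 : 1 / c < 1 := (div_lt_one hc0).2 hc1
    have h2 : 0 < s / n := by positivity
    linarith
  refine ⟨fun _ => c, fun _ => 1 / (1 / c - s / n), isLogHolder_const hc1,
    isLogHolder_const ((one_lt_div hd).2 hd1), (isLogHolder_const hc1).isExponent, ?_,
    fun x => by rw [one_div_one_div]⟩
  rwa [essSup_const _ h0]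

end ConstantExponents

end PadicVarLebesgue

/-! ### The equivalence -/

open PadicVarLebesgue in
theorem theorem2 (p : ℕ) [Fact p.Prime] (n : ℕ) (α β : ℝ)
    (hβ₀ : 0 < β) (hβ₁ : β < 1) (hα : 0 < α) (hαβ : α + β < n)
    (b : Qpn p n → ℝ) (hb : LocallyIntegrable b (haar p n)) :
    List.TFAE [
      ∃ b' : Qpn p n → ℝ, MemLip β b' ∧ b =ᵐ[haar p n] b',
      ∀ r q : Qpn p n → ℝ, IsAdmissible (α + β) r q → IsBoundedOp r q (maxCommutator α b),
      ∃ r q : Qpn p n → ℝ, IsAdmissible (α + β) r q ∧ IsBoundedOp r q (maxCommutator α b),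
      ∃ r q : Qpn p n → ℝ, IsAdmissible (α + β) r q ∧ meanOsc β q b < ∞,
      ∀ r q : Qpn p n → ℝ, IsAdmissible (α + β) r q → meanOsc β q b < ∞] := by
  have hs : 0 < α + β := by positivity
  have hn : n ≠ 0 := by
    rintro rfl
    rw [Nat.cast_zero] at hαβ
    linarith
  obtain ⟨r₀, q₀, hrq₀⟩ := exists_isAdmissible (p := p) hs hαβ
  tfae_have 1 → 2 := by
    rintro ⟨b', hb', hbb⟩ r q hrq
    refine isBoundedOp_of_ae_le_mul_fracMax hn hrq.logHolder_left hrq.logHolder_right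
      (L := (lipNorm β b').toNNReal) (by positivity) hrq.rel
      (fun f hf => aemeasurable_maxCommutator hb.aestronglyMeasurable.aemeasurable hf)
      fun f => ?_
    rw [ENNReal.coe_toNNReal hb'.2.ne]
    exact maxCommutator_le_mul_fracMax hn hβ₀ hb'.2.ne hbb f
  tfae_have 2 → 3 := fun h => ⟨r₀, q₀, hrq₀, h r₀ q₀ hrq₀⟩
  tfae_have 3 → 4 := fun ⟨r, q, hrq, h⟩ =>
    ⟨r, q, hrq, meanOsc_lt_top_of_isBoundedOp hn hα hβ₀ hb hrq h⟩
  tfae_have 4 → 1 := by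
    rintro ⟨r, q, hrq, h⟩
    obtain ⟨D, hD⟩ := exists_ballAvg_enorm_sub_average_le hn hβ₀ hb hrq.logHolder_right h
    exact exists_memLip_of_ballAvg_le hβ₀ hb hD
  tfae_have 1 → 5 := by
    rintro ⟨b', hb', hbb⟩ r q hrq
    exact meanOsc_lt_top_of_memLip hn hβ₀ hb hb' hbb hrq.logHolder_right.isExponent
  tfae_have 5 → 4 := fun h => ⟨r₀, q₀, hrq₀, h r₀ q₀ hrq₀⟩
  tfae_finish
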